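/- **Notation.** Let $g\ge 2$, $N=g(g+1)/2$, and let $\mathcal H_g$ be the space of symmetric complex $g\times g$ matrices $\tau$ with positive definite imaginary part. For $\sigma\in\mathbb F_2^g$ (with entries lifted to $\{0,1\}$) let $$\Theta[\sigma](\tau,z)=\sum_{p\in\mathbb Z^g}\exp\Big(2\pi i\,(p+\tfrac{\sigma}{2})^t\tau(p+\tfrac{\sigma}{2})+4\pi i\,(p+\tfrac{\sigma}{2})^t z\Big),\qquad \Theta[\sigma](\tau)=\Theta[\sigma](\tau,0)$$ be the theta function and theta constant of second order. Put $\partial_{ij}=\tfrac12(1+\delta_{ij})\,\partial/\partial\tau_{ij}$, where $\tau_{ij}=\tau_{ji}$ $(i\le j)$ are the coordinates on $\mathcal H_g$, and $\partial=(\partial_{ij})$. For sets $I,J$ of the same size let $|\partial^I_J|=\det(\partial_{ij})_{i\in I,j\in J}$ as a differential operator (the identity if $I=J=\emptyset$). For $i\le j$ let $d\check\tau_{ij}=d\check\tau_{ji}=\pm\bigwedge_{h\le k,\,(h,k)\ne(i,j)}d\tau_{hk}$ with the sign for which $d\check\tau_{ij}\wedge d\tau_{ij}=\bigwedge_{h\le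 k}d\tau_{hk}$, and $\operatorname{tr}(B\,d\check\tau)=\sum_{i,j}B_{ij}\,d\check\tau_{ij}$. Freitag's pairing of holomorphic functions $f,h$ on $\mathcal H_g$ is the $(N-1)$-form $\{f,h\}=\operatorname{tr}(B^{f,h}\,d\check\tau)$ with $$B^{f,h}_{ij}=(-1)^{i+j}\sum_{k=0}^{g-1}\frac{(-1)^k}{\binom{g-1}{k}}\sum_{I,J}s(I)s(J)\,\big(|\partial^I_J|f\big)\big(|\partial^{I^c}_{J^c}|h\big),$$ where $I$ and $J$ run over the $k$-element subsets of $\{1,\dots,g\}\setminus\{i\}$ and of $\{1,\dots,g\}\setminus\{j\}$, complements are taken in these sets, and $s(I)$ is the sign of the permutation that sorts the sequence $I,I^c$ (each listed increasingly); similarly for $s(J)$. For $\varepsilon,\delta\in\mathbb F_2^g$ put $$A_{\varepsilon\delta}=4\pi i\,\big(\Theta[\varepsilon]\,\partial\Theta[\delta]-\Theta[\delta]\,\partial\Theta[\varepsilon]\big),\qquad (\widetilde A_{\varepsilon\delta})_{ij}=\big(\partial_{z_i}\partial_{z_j}\Theta[\delta]\big)\Theta[\varepsilon]-\big(\partial_{z_i}\partial_{z_j}\Theta[\varepsilon]\big)\Theta[\delta]\quad\text{at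 }z=0,$$ and let $M^{ad}$ denote the adjugate (transposed cofactor matrix) of $M$. **Theorem.** Let $\varepsilon\ne\delta$. The matrix $B^{f,h}$ for $f=\Theta[\varepsilon]^{g-1}$, $h=\Theta[\delta]^{g-1}$ is symmetric at every point of $\mathcal H_g$. If $B_{\varepsilon\delta}$ is any function on $\mathcal H_g$ with values in the symmetric matrices such that $\{\Theta[\varepsilon]^{g-1},\Theta[\delta]^{g-1}\}=\operatorname{tr}(B_{\varepsilon\delta}\,d\check\tau)$, then on $\mathcal H_g$ $$A_{\varepsilon\delta}^{ad}=\frac{(4\pi i)^{g-1}}{(g-1)!}\,B_{\varepsilon\delta}.$$ Moreover $\widetilde A_{\varepsilon\delta}=2A_{\varepsilon\delta}$, so that $\widetilde A_{\varepsilon\delta}^{ad}=\frac{(8\pi i)^{g-1}}{(g-1)!}B_{\varepsilon\delta}$; where $\Theta[\delta]\ne0$ one has $A_{\varepsilon\delta}=-4\pi i\,\Theta[\delta]^2\,\partial\big(\Theta[\varepsilon]/\Theta[\delta]\big)$; and $$\operatorname{tr}(A_{\varepsilon\delta}^{ad}\,d\check\tau)=\frac{(4\pi i)^{g-1}}{(g-1)!}\,\{\Theta[\varepsilon]^{g-1},\Theta[\delta]^{g-1}\}.$$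 -/

import Mathlib

open scoped BigOperators

noncomputable section

namespace SiegelTheta

/-- The Siegel upper half-space of degree `g`: symmetric complex matrices with positive definite
imaginary part. -/
def siegelUpperHalfSpace (g : ℕ) : Set (Matrix (Fin g) (Fin g) ℂ) :=
  {τ | τ.IsSymm ∧ (τ.map Complex.im).PosDef}

/-! ### Theta functions -/

/-- The half-integral vector `ε / 2`, for `ε` with entries `0, 1`. -/
def halfChar {g : ℕ} (ε : Fin g → ZMod 2) : Fin g → ℂ := fun i => ((ε i).val : ℂ) / 2

/-- The theta function with characteristic `[ε, δ]`. -/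
def theta {g : ℕ} (ε δ : Fin g → ZMod 2) (τ : Matrix (Fin g) (Fin g) ℂ) (z : Fin g → ℂ) : ℂ :=
  ∑' p : Fin g → ℤ,
    Complex.exp (Real.pi * Complex.I *
      (((fun i => (p i : ℂ)) + halfChar ε) ⬝ᵥ τ.mulVec ((fun i => (p i : ℂ)) + halfChar ε)
        + 2 * (((fun i => (p i : ℂ)) + halfChar ε) ⬝ᵥ (z + halfChar δ))))

/-- The theta function of second order `Θ[σ](τ, z) = θ[σ, 0](2τ, 2z)`. -/
def thetaTwo {g : ℕ} (σ : Fin g → ZMod 2) (τ : Matrix (Fin g) (Fin g) ℂ) (z : Fin g → ℂ) : ℂ :=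
  theta σ 0 ((2 : ℂ) • τ) ((2 : ℂ) • z)

/-- The theta constant of second order `Θ[σ](τ) = Θ[σ](τ, 0)`. -/
def thetaConst {g : ℕ} (σ : Fin g → ZMod 2) (τ : Matrix (Fin g) (Fin g) ℂ) : ℂ :=
  thetaTwo σ τ 0

/-- The partial derivative `∂F/∂z_i`. -/
def dz {g : ℕ} (i : Fin g) (F : (Fin g → ℂ) → ℂ) (z : Fin g → ℂ) : ℂ :=
  lineDeriv ℂ F z (Pi.single i 1)

/-- The matrix `A_{εδ}` with entries
`(∂_{z_i} ∂_{z_j} Θ[δ]) Θ[ε] - (∂_{z_i} ∂_{z_j} Θ[ε]) Θ[δ]` at `z = 0`. -/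
def thetaA {g : ℕ} (ε δ : Fin g → ZMod 2) (τ : Matrix (Fin g) (Fin g) ℂ) :
    Matrix (Fin g) (Fin g) ℂ :=
  Matrix.of fun i j =>
    dz i (dz j (thetaTwo δ τ)) 0 * thetaConst ε τ - dz i (dz j (thetaTwo ε τ)) 0 * thetaConst δ τ

/-! ### Differential operators in `τ`

The coordinates on the space of symmetric matrices are `τ_{ij}` with `i ≤ j`, and
`τ_{ji} = τ_{ij}`. -/

/-- The coordinate vector field `∂/∂τ_{ij}` on the space of symmetric matrices: it moves the entries
`(i, j)` and `(j, i)` simultaneously. -/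
def coordVec {g : ℕ} (i j : Fin g) : Matrix (Fin g) (Fin g) ℂ :=
  Matrix.of fun a b => if (a = i ∧ b = j) ∨ (a = j ∧ b = i) then 1 else 0

/-- The operator `∂_{ij} = ½ (1 + δ_{ij}) ∂/∂τ_{ij}`. -/
def del {g : ℕ} (i j : Fin g) (f : Matrix (Fin g) (Fin g) ℂ → ℂ)
    (τ : Matrix (Fin g) (Fin g) ℂ) : ℂ :=
  (1 + if i = j then 1 else 0) / 2 * lineDeriv ℂ f τ (coordVec i j)

/-- The matrix `∂f = (∂_{ij} f)`. -/
def delMatrix {g : ℕ} (f : Matrix (Fin g) (Fin g) ℂ → ℂ) (τ : Matrix (Fin g) (Fin g) ℂ) :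
    Matrix (Fin g) (Fin g) ℂ :=
  Matrix.of fun i j => del i j f τ

/-- The minor `|∂^I_J| = det (∂_{ij})_{i ∈ I, j ∈ J}`, a differential operator of order `#I`, applied
to `f`.  It is the Leibniz formula in which products of operators are compositions; `I` and `J` are
enumerated increasingly.  Only `#I = #J` is meaningful.  For `I = J = ∅` it is the identity. -/
def delMinor {g : ℕ} (I J : Finset (Fin g)) (f : Matrix (Fin g) (Fin g) ℂ → ℂ)
    (τ : Matrix (Fin g) (Fin g) ℂ) : ℂ :=
  if h : J.card = I.card then
    ∑ σ : Equiv.Perm (Fin I.card), ((Equiv.Perm.sign σ : ℤ) : ℂ) *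
      (List.ofFn fun a : Fin I.card =>
        del (I.orderEmbOfFin rfl (σ a)) (J.orderEmbOfFin h a)).foldr (fun D F => D F) f τ
  else 0

/-- For a subset `s` of a finite ordered set `α`, the sign of the permutation which turns the
sequence `s, sᶜ` (both enumerated increasingly) into the increasing enumeration of `α`. -/
def shuffleSign {α : Type} [Fintype α] [LinearOrder α] (s : Finset α) : ℤˣ :=
  Equiv.Perm.sign
    ((finSumFinEquiv.symm.trans
      (finSumEquivOfFinset (s := s) (m := s.card) (n := sᶜ.card) rfl rfl)).trans
        (monoEquivOfFin α (k := s.card + sᶜ.card) (Finset.card_add_card_compl s).symm).symm.toEquiv)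

/-- Freitag's matrix `B` attached to the pair `f, h`.  The sets `I` and `J` run through the
`k`-element subsets of `{1, …, g} \ {i}` and of `{1, …, g} \ {j}`, and complements are taken in these
sets. -/
def freitagMatrix {g : ℕ} (f h : Matrix (Fin g) (Fin g) ℂ → ℂ) (τ : Matrix (Fin g) (Fin g) ℂ) :
    Matrix (Fin g) (Fin g) ℂ :=
  Matrix.of fun i j =>
    (-1) ^ (i.val + j.val) * ∑ k ∈ Finset.range g, (-1) ^ k / ((g - 1).choose k : ℂ) *
      ∑ I ∈ Finset.powersetCard k (Finset.univ : Finset {x : Fin g // x ≠ i}),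
        ∑ J ∈ Finset.powersetCard k (Finset.univ : Finset {x : Fin g // x ≠ j}),
          ((shuffleSign I : ℤ) : ℂ) * ((shuffleSign J : ℤ) : ℂ) *
            delMinor (I.map (Function.Embedding.subtype _)) (J.map (Function.Embedding.subtype _)) f τ *
            delMinor (Iᶜ.map (Function.Embedding.subtype _)) (Jᶜ.map (Function.Embedding.subtype _)) h τ

/-! ### Differential forms

The tangent space of the Siegel upper half-space at each point is the space of symmetric matrices.
The value of a differential form at a point is an element of the exterior algebra of the dual of
this space, with the wedge product as multiplication. -/

/-- The space of symmetric `g × g` matrices. -/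
def symMatrices (g : ℕ) : Submodule ℂ (Matrix (Fin g) (Fin g) ℂ) where
  carrier := {M | M.IsSymm}
  add_mem' ha hb := ha.add hb
  zero_mem' := Matrix.isSymm_zero
  smul_mem' c _ h := h.smul c

/-- Values of differential forms at a point. -/
abbrev Forms (g : ℕ) : Type := ExteriorAlgebra ℂ (Module.Dual ℂ (symMatrices g))

/-- The coordinate function `τ_{ij}` as a linear form on symmetric matrices. -/
def coord {g : ℕ} (i j : Fin g) : Module.Dual ℂ (symMatrices g) :=
  (Matrix.entryLinearMap ℂ ℂ i j).comp (symMatrices g).subtype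

/-- The differential `dτ_{ij}`. -/
def dtau {g : ℕ} (p : Fin g × Fin g) : Forms g := ExteriorAlgebra.ι ℂ (coord p.1 p.2)

/-- The pairs `(i, j)` with `i ≤ j`, in lexicographic order. -/
def symPairs (g : ℕ) : List (Fin g × Fin g) :=
  (List.finRange g).flatMap fun i => ((List.finRange g).filter fun j => i ≤ j).map fun j => (i, j)

/-- The wedge product of the `dτ_{ij}` over all `i ≤ j`. -/
def topForm (g : ℕ) : Forms g := ((symPairs g).map dtau).prod

/-- The form `dτ̌_{ij} = ± ⋀_{(h,k) ≠ (i,j)} dτ_{hk}` (`h ≤ k`) for `i ≤ j`, and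
`dτ̌_{ji} = dτ̌_{ij}`.  The exponent of the sign is the number of pairs after `(i, j)`; this is the
sign for which `dτ̌_{ij} ∧ dτ_{ij}` is the wedge product of all `dτ_{hk}`, see
`dtauCheck_mul_dtau`. -/
def dtauCheck {g : ℕ} (i j : Fin g) : Forms g :=
  (-1) ^ ((symPairs g).length - 1 - (symPairs g).idxOf (min i j, max i j)) *
    (((symPairs g).erase (min i j, max i j)).map dtau).prod

/-- `tr (B dτ̌) = ∑_{i,j} B_{ij} dτ̌_{ij}`. -/
def traceForm {g : ℕ} (B : Matrix (Fin g) (Fin g) ℂ) : Forms g :=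
  ∑ i, ∑ j, B i j • dtauCheck i j

/-- Freitag's pairing `{f, h}`, a differential form of degree `g(g+1)/2 - 1`. -/
def freitagPairing {g : ℕ} (f h : Matrix (Fin g) (Fin g) ℂ → ℂ)
    (τ : Matrix (Fin g) (Fin g) ℂ) : Forms g :=
  traceForm (freitagMatrix f h τ)

/-- The matrix `4πi (Θ[ε] ∂Θ[δ] - Θ[δ] ∂Θ[ε])`. -/
def thetaADel {g : ℕ} (ε δ : Fin g → ZMod 2) (τ : Matrix (Fin g) (Fin g) ℂ) :
    Matrix (Fin g) (Fin g) ℂ :=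
  (4 * Real.pi * Complex.I : ℂ) •
    (thetaConst ε τ • delMatrix (thetaConst δ) τ - thetaConst δ τ • delMatrix (thetaConst ε) τ)

/-! ### The sign of `dτ̌` -/

theorem prod_map_dtau_mul {g : ℕ} (l : List (Fin g × Fin g)) (p : Fin g × Fin g) :
    (l.map dtau).prod * dtau p = (-1) ^ l.length * (dtau p * (l.map dtau).prod) := by
  induction l with
  | nil => simp
  | cons q l ih =>
    have hc : dtau q * dtau p = -(dtau p * dtau q) := by
      have := ExteriorAlgebra.ι_add_mul_swap (R := ℂ) (coord q.1 q.2) (coord p.1 p.2)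
      exact eq_neg_of_add_eq_zero_left this
    have hm : ((-1 : Forms g) ^ l.length) * dtau q = dtau q * (-1) ^ l.length :=
      ((Commute.neg_one_left (dtau q)).pow_left _).eq
    rw [List.map_cons, List.prod_cons, mul_assoc, ih, ← mul_assoc (dtau q), ← hm, mul_assoc,
      ← mul_assoc (dtau q), hc, List.length_cons, pow_succ]
    simp [mul_assoc]

theorem sign_erase_mul_dtau {g : ℕ} (l : List (Fin g × Fin g)) (p : Fin g × Fin g) (hp : p ∈ l) :
    (-1) ^ (l.length - 1 - l.idxOf p) * ((l.erase p).map dtau).prod * dtau p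
      = (l.map dtau).prod := by
  induction l with
  | nil => simp at hp
  | cons q l ih =>
    by_cases hq : q = p
    · subst hq
      rw [List.erase_cons_head, mul_assoc, prod_map_dtau_mul, ← mul_assoc, ← pow_add]
      simp [← two_mul]
    · have hp' : p ∈ l := by
        rcases List.mem_cons.1 hp with h | h
        · exact absurd h.symm hq
        · exact h
      rw [List.erase_cons_tail (by simpa using hq), List.idxOf_cons_ne _ hq, List.map_cons,
        List.prod_cons, List.map_cons, List.prod_cons, ← ih hp']
      have e : (q :: l).length - 1 - (l.idxOf p).succ = l.length - 1 - l.idxOf p := by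
        simp only [List.length_cons]; omega
      have hm : ((-1 : Forms g) ^ (l.length - 1 - l.idxOf p)) * dtau q
          = dtau q * (-1) ^ (l.length - 1 - l.idxOf p) :=
        ((Commute.neg_one_left (dtau q)).pow_left _).eq
      rw [e, ← mul_assoc, hm]
      simp only [mul_assoc]

/-- The defining property of `dτ̌_{ij}`. -/
theorem dtauCheck_mul_dtau {g : ℕ} (i j : Fin g) (hij : i ≤ j) :
    dtauCheck i j * dtau (i, j) = topForm g := by
  unfold dtauCheck topForm
  rw [min_eq_left hij, max_eq_right hij]
  exact sign_erase_mul_dtau _ _ (by simp [symPairs, hij])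

end SiegelTheta

end

open scoped BigOperators

noncomputable section

namespace SiegelTheta

/-! ### Rapidly decaying families -/

/-! Put `n = g - 1` and write `q = p + σ/2`. The power `Θ[σ]^n` is a sum over `n`-tuples of lattice
points of `exp (2πi tr (M τ))`, where `M = ∑ₐ qₐ qₐᵗ`, and `∂_{ij}` multiplies such a term by `2πi
M_{ij}`. A minor of `∂` of size `k` therefore multiplies it by a minor of a sum of `n` rank one
matrices. Expanding that minor by columns, each column chooses one of the `n` summands. If two
columns choose the same summand, the signed sum vanishes. Each of the `n (n-1) ⋯ (n-k+1)` injective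
choices separates the lattice variables and gives the same value, so `|∂^I_J| Θ^n = n (n-1) ⋯
(n-k+1) · Θ^(n-k) · det (∂_{ij} Θ)_{i ∈ I, j ∈ J}`. No derivative of order above one survives. This
is `delMinor_thetaConst_pow`, resting on `sum_sign_mul_tsum_prod`.

In Freitag's matrix the two falling factorials divided by the binomial coefficient give `n!` for
every `k`. The remaining sum over `k, I, J` is the Laplace expansion (`det_add_submatrix_orderIso`)
of the determinant of `Θ[ε] ∂Θ[δ] - Θ[δ] ∂Θ[ε]` with row `i` and column `j` removed. With the sign
`(-1)^(i+j)` this is an entry of the adjugate (`freitagMatrix_thetaConst_pow`).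

Any other admissible `B` agrees with Freitag's matrix because the trace form determines a symmetric
matrix (`traceForm_injective`). The version with `z`-derivatives follows from the heat equation
`dz_dz_thetaTwo`. The analytic part justifies termwise differentiation and the rearrangement of the
series. -/

theorem summable_norm_prod_pi {X : Type*} {n : ℕ} (f : Fin n → X → ℂ)
    (hf : ∀ a, Summable fun x => ‖f a x‖) :
    (Summable fun P : Fin n → X => ‖∏ a, f a (P a)‖) ∧
      ∑' P : Fin n → X, ∏ a, f a (P a) = ∏ a, ∑' x, f a x := by
  induction n with
  | zero =>
    refine ⟨(hasSum_fintype _).summable, ?_⟩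
    simp
  | succ n ih =>
    obtain ⟨h1, h2⟩ := ih (fun a => f a.succ) fun a => hf a.succ
    constructor
    · rw [← (Fin.consEquiv (fun _ : Fin (n + 1) => X)).summable_iff]
      refine ((hf 0).mul_norm h1).congr fun x => ?_
      simp [Fin.consEquiv, Fin.prod_univ_succ]
    · rw [← (Fin.consEquiv (fun _ : Fin (n + 1) => X)).tsum_eq, Fin.prod_univ_succ, ← h2,
        tsum_mul_tsum_of_summable_norm (hf 0) h1]
      refine tsum_congr fun x => ?_
      simp [Fin.consEquiv, Fin.prod_univ_succ]

/-- The family `w` is summable against an exponential of the weight `N`. -/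
def RapidDecay {X : Type*} (N : X → ℝ) (w : X → ℂ) : Prop :=
  ∃ r > 0, Summable fun x => ‖w x‖ * Real.exp (r * N x)

namespace RapidDecay

variable {X : Type*} {N : X → ℝ} {w b : X → ℂ} {C : ℝ}

theorem summable_norm (hN : ∀ x, 0 ≤ N x) (h : RapidDecay N w) : Summable fun x => ‖w x‖ := by
  obtain ⟨r, hr, h⟩ := h
  refine h.of_nonneg_of_le (fun x => norm_nonneg _) fun x => ?_
  exact le_mul_of_one_le_right (norm_nonneg _) (Real.one_le_exp (mul_nonneg hr.le (hN x)))

/-- A factor of linear growth in `N` is absorbed by half of the exponential. Since the rate is only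
required to exist, this can be repeated for any number of derivatives. -/
theorem mul_of_norm_le (hN : ∀ x, 0 ≤ N x) (h : RapidDecay N w) (hb : ∀ x, ‖b x‖ ≤ C * N x) :
    RapidDecay N fun x => b x * w x := by
  obtain ⟨r, hr, h⟩ := h
  refine ⟨r / 2, half_pos hr, (h.mul_left (|C| * (2 / r))).of_nonneg_of_le
    (fun x => by positivity) fun x => ?_⟩
  have h1 : N x ≤ 2 / r * Real.exp (r / 2 * N x) := by
    have := Real.add_one_le_exp (r / 2 * N x)
    have h2 : 2 / r * (r / 2 * N x) ≤ 2 / r * Real.exp (r / 2 * N x) :=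
      mul_le_mul_of_nonneg_left (by linarith) (by positivity)
    have h3 : 2 / r * (r / 2 * N x) = N x := by field_simp
    linarith
  have h4 : ‖b x‖ ≤ |C| * (2 / r * Real.exp (r / 2 * N x)) :=
    (hb x).trans ((mul_le_mul_of_nonneg_right (le_abs_self C) (hN x)).trans
      (mul_le_mul_of_nonneg_left h1 (abs_nonneg C)))
  have h5 : Real.exp (r * N x) = Real.exp (r / 2 * N x) * Real.exp (r / 2 * N x) := by
    rw [← Real.exp_add]; ring_nf
  calc ‖b x * w x‖ * Real.exp (r / 2 * N x)
      = ‖b x‖ * (‖w x‖ * Real.exp (r / 2 * N x)) := by rw [norm_mul]; ring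
    _ ≤ |C| * (2 / r * Real.exp (r / 2 * N x)) * (‖w x‖ * Real.exp (r / 2 * N x)) :=
      mul_le_mul_of_nonneg_right h4 (by positivity)
    _ = |C| * (2 / r) * (‖w x‖ * Real.exp (r * N x)) := by rw [h5]; ring

/-- For `|t| < r / (|C| + 1)` the terms are dominated by the summable family `‖w x‖ exp (r N x)`, so
a locally uniform limit of holomorphic functions may be differentiated termwise. The `+ 1` keeps the
radius meaningful when `C = 0`. -/
theorem hasDerivAt (hN : ∀ x, 0 ≤ N x) (h : RapidDecay N w) (hb : ∀ x, ‖b x‖ ≤ C * N x) :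
    HasDerivAt (fun t : ℂ => ∑' x, Complex.exp (t * b x) * w x) (∑' x, b x * w x) 0 := by
  obtain ⟨r, hr, h⟩ := h
  have hd : ∀ x (t : ℂ), HasDerivAt (fun t : ℂ => Complex.exp (t * b x) * w x)
      (Complex.exp (t * b x) * b x * w x) t := fun x t => by
    simpa using (((hasDerivAt_id t).mul_const (b x)).cexp.mul_const (w x))
  have hle : ∀ x (t : ℂ), t ∈ Metric.ball (0 : ℂ) (r / (|C| + 1)) →
      ‖Complex.exp (t * b x) * w x‖ ≤ ‖w x‖ * Real.exp (r * N x) := fun x t ht => by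
    rw [norm_mul, mul_comm]
    refine mul_le_mul_of_nonneg_left ?_ (norm_nonneg _)
    rw [Complex.norm_exp]
    refine Real.exp_le_exp.2 ((Complex.re_le_norm _).trans ?_)
    rw [norm_mul]
    have ht' : ‖t‖ ≤ r / (|C| + 1) := by simpa using (Metric.mem_ball.1 ht).le
    have hbx : ‖b x‖ ≤ (|C| + 1) * N x :=
      (hb x).trans (mul_le_mul_of_nonneg_right (by linarith [le_abs_self C]) (hN x))
    calc ‖t‖ * ‖b x‖ ≤ r / (|C| + 1) * ((|C| + 1) * N x) :=
          mul_le_mul ht' hbx (norm_nonneg _) (by positivity)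
      _ = r * N x := by field_simp
  have hdiff : ∀ x, DifferentiableOn ℂ (fun t : ℂ => Complex.exp (t * b x) * w x)
      (Metric.ball (0 : ℂ) (r / (|C| + 1))) :=
    fun x t _ => (hd x t).differentiableAt.differentiableWithinAt
  have h0 : (0 : ℂ) ∈ Metric.ball (0 : ℂ) (r / (|C| + 1)) :=
    Metric.mem_ball_self (by positivity)
  have hs := Complex.hasSum_deriv_of_summable_norm h hdiff Metric.isOpen_ball hle h0
  have hdo := Complex.differentiableOn_tsum_of_summable_norm h hdiff Metric.isOpen_ball hle
  have := (hdo.differentiableAt (Metric.isOpen_ball.mem_nhds h0)).hasDerivAt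
  rw [← hs.tsum_eq] at this
  simpa [(hd _ _).deriv] using this

theorem prod {n : ℕ} (h : RapidDecay N w) :
    RapidDecay (fun P : Fin n → X => ∑ a, N (P a)) fun P => ∏ a, w (P a) := by
  obtain ⟨r, hr, h⟩ := h
  refine ⟨r, hr, ?_⟩
  have := (summable_norm_prod_pi (n := n)
    (fun _ x => ((‖w x‖ * Real.exp (r * N x) : ℝ) : ℂ)) fun _ =>
      h.congr fun x => by rw [Complex.norm_real, Real.norm_of_nonneg (by positivity)]).1
  refine this.congr fun P => ?_
  rw [norm_prod, norm_prod, Finset.mul_sum, Real.exp_sum, ← Finset.prod_mul_distrib]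
  refine Finset.prod_congr rfl fun a _ => ?_
  rw [Complex.norm_real, Real.norm_of_nonneg (by positivity)]

end RapidDecay

/-! ### The domain of convergence -/

/-- Matrices whose imaginary part has a positive definite symmetric part. -/
def convDomain (g : ℕ) : Set (Matrix (Fin g) (Fin g) ℂ) :=
  {τ | ∃ c > 0, ∀ x : Fin g → ℝ, c * ∑ i, x i ^ 2 ≤ ∑ i, ∑ j, x i * x j * (τ i j).im}

/-- The constant is the minimum of the quadratic form on the compact unit sphere, extended to all
vectors by homogeneity. -/
theorem siegelUpperHalfSpace_subset_convDomain (g : ℕ) :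
    siegelUpperHalfSpace g ⊆ convDomain g := by
  intro τ hτ
  set Q : (Fin g → ℝ) → ℝ := fun x => ∑ i, ∑ j, x i * x j * (τ i j).im with hQ
  have hpos : ∀ x : Fin g → ℝ, x ≠ 0 → 0 < Q x := fun x hx => by
    have := (Matrix.posDef_iff_dotProduct_mulVec.1 hτ.2).2 hx
    simpa [hQ, dotProduct, Matrix.mulVec, Finset.mul_sum, mul_assoc, mul_left_comm, mul_comm]
      using this
  have hsmul : ∀ (a : ℝ) x, Q (a • x) = a ^ 2 * Q x := fun a x => by
    simp only [hQ, Finset.mul_sum, Pi.smul_apply, smul_eq_mul]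
    refine Finset.sum_congr rfl fun i _ => Finset.sum_congr rfl fun j _ => by ring
  have hcont : Continuous Q := by fun_prop
  have hcomp : IsCompact {x : Fin g → ℝ | ∑ i, x i ^ 2 = 1} := by
    refine (isCompact_closedBall (0 : Fin g → ℝ) 1).of_isClosed_subset
      (isClosed_eq (by fun_prop) continuous_const) fun x hx => ?_
    rw [mem_closedBall_zero_iff, pi_norm_le_iff_of_nonneg zero_le_one]
    intro i
    have : x i ^ 2 ≤ ∑ i, x i ^ 2 :=
      Finset.single_le_sum (f := fun i => x i ^ 2) (fun _ _ => sq_nonneg _) (Finset.mem_univ i)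
    rw [show ∑ i, x i ^ 2 = 1 from hx] at this
    rw [Real.norm_eq_abs]
    exact (sq_le_one_iff_abs_le_one _).1 this
  obtain ⟨c, hc, hmin⟩ : ∃ c > 0, ∀ x : Fin g → ℝ, ∑ i, x i ^ 2 = 1 → c ≤ Q x := by
    rcases Set.eq_empty_or_nonempty {x : Fin g → ℝ | ∑ i, x i ^ 2 = 1} with h | h
    · exact ⟨1, one_pos, fun x hx => (Set.eq_empty_iff_forall_notMem.1 h x hx).elim⟩
    · obtain ⟨y, hy, hmin⟩ := hcomp.exists_isMinOn h hcont.continuousOn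
      refine ⟨Q y, hpos y ?_, fun x hx => hmin hx⟩
      rintro rfl
      simp at hy
  refine ⟨c, hc, fun x => ?_⟩
  change _ ≤ Q x
  have hs0 : 0 ≤ ∑ i, x i ^ 2 := Finset.sum_nonneg fun _ _ => sq_nonneg _
  rcases hs0.eq_or_lt with h0 | h0
  · have hx : x = 0 := by
      funext i
      have := (Finset.sum_eq_zero_iff_of_nonneg fun i _ => sq_nonneg (x i)).1 h0.symm i
        (Finset.mem_univ i)
      simpa using this
    simp [hx, hQ]
  · set s := ∑ i, x i ^ 2 with hs
    have h1 := hmin ((Real.sqrt s)⁻¹ • x) (by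
      simp only [Pi.smul_apply, smul_eq_mul, mul_pow, ← Finset.mul_sum, ← hs, inv_pow,
        Real.sq_sqrt hs0]
      exact inv_mul_cancel₀ h0.ne')
    rw [hsmul, inv_pow, Real.sq_sqrt hs0, inv_mul_eq_div, le_div_iff₀ h0] at h1
    exact h1

/-- This openness along lines is the reason for working on `convDomain`: series identities valid
there can be differentiated again, in any matrix direction. -/
theorem eventually_mem_convDomain {g : ℕ} {τ : Matrix (Fin g) (Fin g) ℂ} (hτ : τ ∈ convDomain g)
    (V : Matrix (Fin g) (Fin g) ℂ) : ∀ᶠ t : ℂ in nhds 0, τ + t • V ∈ convDomain g := by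
  obtain ⟨c, hc, h⟩ := hτ
  have hlim : Filter.Tendsto (fun t : ℂ => ∑ i, ∑ j, ‖t * V i j‖) (nhds 0) (nhds 0) := by
    have : Continuous (fun t : ℂ => ∑ i, ∑ j, ‖t * V i j‖) := by fun_prop
    simpa using this.tendsto 0
  filter_upwards [hlim.eventually (gt_mem_nhds (half_pos hc))] with t ht
  refine ⟨c / 2, half_pos hc, fun x => ?_⟩
  have hs0 : 0 ≤ ∑ i, x i ^ 2 := Finset.sum_nonneg fun _ _ => sq_nonneg _
  have h1 : ∀ i j, -(‖t * V i j‖ * ∑ i, x i ^ 2) ≤ x i * x j * (t * V i j).im := fun i j => by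
    have hi : x i ^ 2 ≤ ∑ i, x i ^ 2 :=
      Finset.single_le_sum (f := fun i => x i ^ 2) (fun _ _ => sq_nonneg _) (Finset.mem_univ i)
    have hj : x j ^ 2 ≤ ∑ i, x i ^ 2 :=
      Finset.single_le_sum (f := fun i => x i ^ 2) (fun _ _ => sq_nonneg _) (Finset.mem_univ j)
    have hij : |x i * x j| ≤ ∑ i, x i ^ 2 := by
      rw [abs_le]; constructor <;> nlinarith [sq_nonneg (x i + x j), sq_nonneg (x i - x j)]
    refine neg_le_of_abs_le ?_
    rw [abs_mul, mul_comm]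
    exact mul_le_mul (Complex.abs_im_le_norm _) hij (abs_nonneg _) (norm_nonneg _)
  have h2 : -((∑ i, ∑ j, ‖t * V i j‖) * ∑ i, x i ^ 2)
      ≤ ∑ i, ∑ j, x i * x j * (t * V i j).im := by
    rw [Finset.sum_mul, ← Finset.sum_neg_distrib]
    refine Finset.sum_le_sum fun i _ => ?_
    rw [Finset.sum_mul, ← Finset.sum_neg_distrib]
    exact Finset.sum_le_sum fun j _ => h1 i j
  have h3 : ∑ i, ∑ j, x i * x j * ((τ + t • V) i j).im
      = ∑ i, ∑ j, x i * x j * (τ i j).im + ∑ i, ∑ j, x i * x j * (t * V i j).im := by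
    simp only [← Finset.sum_add_distrib]
    refine Finset.sum_congr rfl fun i _ => Finset.sum_congr rfl fun j _ => ?_
    rw [Matrix.add_apply, Matrix.smul_apply, smul_eq_mul, Complex.add_im]; ring
  have h4 := mul_le_mul_of_nonneg_right ht.le hs0
  rw [h3]
  linarith [h x]

/-! ### Decay of the terms of the theta series -/

/-- Since `(n + s/2)² ≥ n² - |n|` and `|n + s/2| ≤ |n| + 1`, the shift costs only `c |n|` in the
exponent and a factor `exp S`; the rest is the bound for the Jacobi theta series. -/
theorem summable_exp_neg_sq_shift {c : ℝ} (hc : 0 < c) {S s : ℝ} (hS : 0 ≤ S) (hs : 0 ≤ s)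
    (hs' : s ≤ 1) :
    Summable fun n : ℤ => Real.exp (-c * (n + s / 2) ^ 2 + S * |(n : ℝ) + s / 2|) := by
  have h := (summable_pow_mul_jacobiTheta₂_term_bound ((c + S) / (2 * Real.pi))
    (T := c / Real.pi) (by positivity) 0).mul_left (Real.exp S)
  refine h.of_nonneg_of_le (fun _ => (Real.exp_pos _).le) fun n => ?_
  rw [pow_zero, one_mul, ← Real.exp_add, Real.exp_le_exp]
  have e : -Real.pi * (c / Real.pi * (n : ℝ) ^ 2 - 2 * ((c + S) / (2 * Real.pi)) * |(n : ℝ)|)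
      = -c * (n : ℝ) ^ 2 + (c + S) * |(n : ℝ)| := by
    field_simp; ring
  have hn : -|(n : ℝ)| ≤ n * s := by
    have := neg_abs_le (n : ℝ)
    have h0 := abs_nonneg (n : ℝ)
    nlinarith
  have h1 : |(n : ℝ) + s / 2| ≤ |(n : ℝ)| + 1 := by
    refine (abs_add_le _ _).trans ?_
    rw [abs_of_nonneg (by linarith : 0 ≤ s / 2)]; linarith
  have h2 := mul_le_mul_of_nonneg_left h1 hS
  have h3 : (n : ℝ) ^ 2 - |(n : ℝ)| ≤ (n + s / 2) ^ 2 := by nlinarith [sq_nonneg s]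
  have h4 := mul_le_mul_of_nonneg_left h3 hc.le
  push_cast
  linarith

/-- The summation vector `p + σ / 2`. -/
def shiftVec {g : ℕ} (σ : Fin g → ZMod 2) (p : Fin g → ℤ) (i : Fin g) : ℝ :=
  p i + ((σ i).val : ℝ) / 2

/-- The weight `1 + |q|²` of `q = p + σ / 2`. -/
def shiftWeight {g : ℕ} (σ : Fin g → ZMod 2) (p : Fin g → ℤ) : ℝ :=
  1 + ∑ i, shiftVec σ p i ^ 2

theorem shiftWeight_nonneg {g : ℕ} (σ : Fin g → ZMod 2) (p : Fin g → ℤ) : 0 ≤ shiftWeight σ p :=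
  add_nonneg zero_le_one (Finset.sum_nonneg fun _ _ => sq_nonneg _)

theorem sq_shiftVec_le {g : ℕ} (σ : Fin g → ZMod 2) (p : Fin g → ℤ) (i : Fin g) :
    shiftVec σ p i ^ 2 ≤ shiftWeight σ p - 1 := by
  have := Finset.single_le_sum (f := fun i => shiftVec σ p i ^ 2) (fun _ _ => sq_nonneg _)
    (Finset.mem_univ i)
  simp only [shiftWeight]; linarith

/-- The summand `1` in the weight makes it dominate factors linear in `q`, which arise from
`z`-derivatives. -/
theorem abs_shiftVec_le {g : ℕ} (σ : Fin g → ZMod 2) (p : Fin g → ℤ) (i : Fin g) :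
    |shiftVec σ p i| ≤ shiftWeight σ p := by
  have := sq_shiftVec_le σ p i
  rw [← sq_abs] at this
  nlinarith [sq_nonneg (|shiftVec σ p i| - 1), abs_nonneg (shiftVec σ p i)]

theorem abs_shiftVec_mul_le {g : ℕ} (σ : Fin g → ZMod 2) (p : Fin g → ℤ) (i j : Fin g) :
    |shiftVec σ p i * shiftVec σ p j| ≤ shiftWeight σ p := by
  have hi := sq_shiftVec_le σ p i
  have hj := sq_shiftVec_le σ p j
  rw [abs_le]
  constructor <;> nlinarith [sq_nonneg (shiftVec σ p i + shiftVec σ p j),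
    sq_nonneg (shiftVec σ p i - shiftVec σ p j)]

/-- The term of the second order theta series at `p`. -/
def thetaTerm {g : ℕ} (σ : Fin g → ZMod 2) (τ : Matrix (Fin g) (Fin g) ℂ) (z : Fin g → ℂ)
    (p : Fin g → ℤ) : ℂ :=
  Complex.exp (2 * Real.pi * Complex.I *
      (∑ i, ∑ j, ((shiftVec σ p i * shiftVec σ p j : ℝ) : ℂ) * τ i j) +
    4 * Real.pi * Complex.I * ∑ i, (shiftVec σ p i : ℂ) * z i)

theorem thetaTwo_eq_tsum {g : ℕ} (σ : Fin g → ZMod 2) (τ : Matrix (Fin g) (Fin g) ℂ)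
    (z : Fin g → ℂ) : thetaTwo σ τ z = ∑' p, thetaTerm σ τ z p := by
  unfold thetaTwo theta
  refine tsum_congr fun p => ?_
  unfold thetaTerm
  congr 1
  have h : ∀ i, (p i : ℂ) + halfChar σ i = (shiftVec σ p i : ℂ) := fun i => by
    rw [shiftVec, halfChar]; push_cast; rfl
  have h0 : ∀ i, halfChar (0 : Fin g → ZMod 2) i = 0 := fun i => by simp [halfChar]
  simp only [dotProduct, Matrix.mulVec, Pi.add_apply, h, h0, Pi.smul_apply, Matrix.smul_apply,
    smul_eq_mul, add_zero, Finset.mul_sum, mul_add]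
  congr 1
  · refine Finset.sum_congr rfl fun i _ => Finset.sum_congr rfl fun j _ => ?_
    push_cast; ring
  · refine Finset.sum_congr rfl fun i _ => ?_
    ring

/-- The term has norm at most `exp (-2πc |q|² - 4π q · Im z)`. Half of the Gaussian decay pays for
the weight with rate `πc`; the other half leaves a product of one-variable series. -/
theorem rapidDecay_thetaTerm {g : ℕ} (σ : Fin g → ZMod 2) {τ : Matrix (Fin g) (Fin g) ℂ}
    (hτ : τ ∈ convDomain g) (z : Fin g → ℂ) : RapidDecay (shiftWeight σ) (thetaTerm σ τ z) := by
  obtain ⟨c, hc, h⟩ := hτ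
  have hpc : 0 < Real.pi * c := by positivity
  refine ⟨Real.pi * c, hpc, ?_⟩
  have hsum := (summable_norm_prod_pi (n := g) (X := ℤ)
    (fun i n => ((Real.exp (-(Real.pi * c) * (n + ((σ i).val : ℝ) / 2) ^ 2 +
      (4 * Real.pi * |(z i).im|) * |(n : ℝ) + ((σ i).val : ℝ) / 2|) : ℝ) : ℂ)) fun i => by
        have hv : ((σ i).val : ℝ) ≤ 1 := by
          exact_mod_cast Nat.lt_succ_iff.1 (ZMod.val_lt (σ i))
        have := summable_exp_neg_sq_shift hpc (S := 4 * Real.pi * |(z i).im|)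
          (s := (σ i).val) (by positivity) (by positivity) hv
        refine this.congr fun n => ?_
        rw [Complex.norm_real, Real.norm_of_nonneg (Real.exp_pos _).le]).1
  refine (hsum.mul_left (Real.exp (Real.pi * c))).of_nonneg_of_le (fun p => by positivity)
    fun p => ?_
  rw [norm_prod]
  simp only [Complex.norm_real, Real.norm_of_nonneg (Real.exp_pos _).le]
  rw [← Real.exp_sum, ← Real.exp_add, thetaTerm, Complex.norm_exp, ← Real.exp_add,
    Real.exp_le_exp]
  have e1 : (2 * Real.pi * Complex.I *
      (∑ i, ∑ j, ((shiftVec σ p i * shiftVec σ p j : ℝ) : ℂ) * τ i j) +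
    4 * Real.pi * Complex.I * ∑ i, (shiftVec σ p i : ℂ) * z i).re
      = -(2 * Real.pi) * (∑ i, ∑ j, shiftVec σ p i * shiftVec σ p j * (τ i j).im)
        + ∑ i, -(4 * Real.pi) * (shiftVec σ p i * (z i).im) := by
    have a1 : (2 * Real.pi * Complex.I : ℂ) = ((2 * Real.pi : ℝ) : ℂ) * Complex.I := by
      push_cast; ring
    have a2 : (4 * Real.pi * Complex.I : ℂ) = ((4 * Real.pi : ℝ) : ℂ) * Complex.I := by
      push_cast; ring
    rw [a1, a2, Complex.add_re, mul_assoc, mul_assoc, Complex.re_ofReal_mul,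
      Complex.re_ofReal_mul, Complex.I_mul_re, Complex.I_mul_re, Complex.im_sum, Complex.im_sum,
      ← Finset.mul_sum]
    simp only [Complex.im_sum, Complex.im_ofReal_mul]
    ring
  have e2 : ∀ i, -(4 * Real.pi) * (shiftVec σ p i * (z i).im)
      ≤ 4 * Real.pi * |(z i).im| * |shiftVec σ p i| := fun i => by
    have h1 := neg_abs_le (shiftVec σ p i * (z i).im)
    rw [abs_mul] at h1
    nlinarith [Real.pi_pos]
  have e3 := Finset.sum_le_sum fun i (_ : i ∈ Finset.univ) => e2 i
  have e4 := mul_le_mul_of_nonneg_left (h (shiftVec σ p)) (by positivity : 0 ≤ 2 * Real.pi)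
  rw [e1, Finset.sum_add_distrib]
  simp only [shiftWeight]
  simp only [← shiftVec.eq_1]
  rw [← Finset.mul_sum (a := -(Real.pi * c))]
  linarith

/-! ### Laplace expansion of the determinant of a sum -/

theorem shuffleSign_eq_sign {α : Type} [Fintype α] [LinearOrder α] {k m : ℕ}
    (s : Finset α) (hk : s.card = k) (hm : sᶜ.card = m) (e : Fin (k + m) ≃o α) :
    shuffleSign s = Equiv.Perm.sign
      ((finSumFinEquiv.symm.trans (finSumEquivOfFinset hk hm)).trans e.symm.toEquiv) := by
  subst hk hm
  unfold shuffleSign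
  rw [Subsingleton.elim (monoEquivOfFin α _).symm e.symm]

section Minor

variable {α β : Type} [LinearOrder α] [LinearOrder β] {R : Type*} [CommRing R]

/-- The minor of `A` with rows `I` and columns `J`, enumerated increasingly. -/
def minorDet (A : Matrix α β R) (I : Finset α) (J : Finset β) : R :=
  if h : J.card = I.card then (A.submatrix (I.orderEmbOfFin rfl) (J.orderEmbOfFin h)).det else 0

theorem minorDet_eq {k : ℕ} (A : Matrix α β R) {I : Finset α} {J : Finset β} (hI : I.card = k)
    (hJ : J.card = k) :
    minorDet A I J = (A.submatrix (I.orderEmbOfFin hI) (J.orderEmbOfFin hJ)).det := by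
  subst hI
  rw [minorDet, dif_pos hJ]

theorem minorDet_smul (c : R) (A : Matrix α β R) (I : Finset α) (J : Finset β) :
    minorDet (c • A) I J = c ^ I.card * minorDet A I J := by
  unfold minorDet
  split_ifs with h
  · rw [Matrix.submatrix_smul, Pi.smul_apply, Pi.smul_apply, Matrix.det_smul, Fintype.card_fin]
  · rw [mul_zero]

end Minor

section Laplace

variable {α β : Type} [Fintype α] [LinearOrder α] [Fintype β] [LinearOrder β]
  {R : Type*} [CommRing R]

/-- Rows and columns have different index types, as needed when row `i` and column `j` are deleted;
permutations become bijections `β ≃ α`, with signs read off through the increasing enumerations. -/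
theorem det_submatrix_orderIso {n : ℕ} (A : Matrix α β R) (eα : Fin n ≃o α) (eβ : Fin n ≃o β) :
    (A.submatrix eα eβ).det = ∑ τ : β ≃ α,
      ((Equiv.Perm.sign ((eβ.toEquiv.trans τ).trans eα.symm.toEquiv) : ℤ) : R) *
        ∏ y, A (τ y) y := by
  rw [Matrix.det_apply']
  refine Fintype.sum_equiv (Equiv.equivCongr eβ.toEquiv eα.toEquiv) _ _ fun σ => ?_
  congr 1
  · congr 3
    ext x
    simp
  · rw [← eβ.toEquiv.prod_comp]
    simp

/-- The bijections which map `J` onto `I` contribute the products of complementary minors. -/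
theorem sum_equiv_fiber {n k : ℕ} (A B : Matrix α β R) (eα : Fin n ≃o α) (eβ : Fin n ≃o β)
    (I : Finset α) (J : Finset β) (hI : I.card = k) (hJ : J.card = k) :
    ∑ τ : β ≃ α with J.map τ.toEmbedding = I,
      ((Equiv.Perm.sign ((eβ.toEquiv.trans τ).trans eα.symm.toEquiv) : ℤ) : R) *
        ((∏ y ∈ J, A (τ y) y) * ∏ y ∈ Jᶜ, B (τ y) y)
    = ((shuffleSign I : ℤ) : R) * ((shuffleSign J : ℤ) : R) * minorDet A I J *
      minorDet B Iᶜ Jᶜ := by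
  obtain ⟨m, rfl⟩ : ∃ m, n = k + m := by
    refine Nat.exists_eq_add_of_le ?_
    have := I.card_le_univ
    rw [← Fintype.card_congr eα.toEquiv, Fintype.card_fin] at this
    omega
  have hIc : Iᶜ.card = m := by
    have := I.card_add_card_compl
    rw [← Fintype.card_congr eα.toEquiv, Fintype.card_fin] at this
    omega
  have hJc : Jᶜ.card = m := by
    have := J.card_add_card_compl
    rw [← Fintype.card_congr eβ.toEquiv, Fintype.card_fin] at this
    omega
  rw [minorDet_eq A hI hJ, minorDet_eq B hIc hJc, Matrix.det_apply', Matrix.det_apply',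
    mul_assoc _ (Finset.sum _ _), Finset.sum_mul_sum, ← Finset.sum_product', Finset.mul_sum]
  set EI := finSumEquivOfFinset hI hIc with hEI
  set EJ := finSumEquivOfFinset hJ hJc with hEJ
  have memI : ∀ x, EI x ∈ I ↔ x.isLeft := by
    rintro (x | x)
    · simp [hEI]
    · have := Finset.mem_compl.1 (Iᶜ.orderEmbOfFin_mem hIc x)
      rw [hEI, finSumEquivOfFinset_inr]
      simpa only [Sum.isLeft_inr, Bool.false_eq_true, iff_false] using this
  have memJ : ∀ x, EJ x ∈ J ↔ x.isLeft := by
    rintro (x | x)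
    · simp [hEJ]
    · have := Finset.mem_compl.1 (Jᶜ.orderEmbOfFin_mem hJc x)
      rw [hEJ, finSumEquivOfFinset_inr]
      simpa only [Sum.isLeft_inr, Bool.false_eq_true, iff_false] using this
  symm
  -- A bijection carrying `J` onto `I` is the same as a permutation `a` for the sets themselves and
  -- a permutation `b` for their complements.
  refine Finset.sum_bij
    (fun ab _ => EJ.symm.trans ((Equiv.Perm.sumCongr ab.1 ab.2).trans EI)) ?_ ?_ ?_ ?_
  · rintro ⟨a, b⟩ -
    rw [Finset.mem_filter]
    refine ⟨Finset.mem_univ _, Finset.eq_of_subset_of_card_le ?_ ?_⟩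
    · intro x hx
      obtain ⟨y, hy, rfl⟩ := Finset.mem_map.1 hx
      obtain ⟨u, rfl⟩ := EJ.surjective y
      rw [memJ] at hy
      obtain ⟨v, rfl⟩ := Sum.isLeft_iff.1 hy
      simp [memI]
    · rw [Finset.card_map, hI, hJ]
  · rintro ⟨a, b⟩ - ⟨a', b'⟩ - h
    have h' : Equiv.Perm.sumCongr a b = Equiv.Perm.sumCongr a' b' := by
      ext x
      have := congrArg (fun e => EI.symm (e (EJ x))) h
      simpa using this
    have := Equiv.Perm.sumCongrHom_injective (a₁ := (a, b)) (a₂ := (a', b')) h'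
    exact this
  · intro τ hτ
    have hτ' := (Finset.mem_filter.1 hτ).2
    have hmap : Set.MapsTo (EJ.trans (τ.trans EI.symm)) (Set.range Sum.inl)
        (Set.range Sum.inl) := by
      rintro _ ⟨x, rfl⟩
      have : τ (EJ (Sum.inl x)) ∈ I := by
        rw [← hτ']
        exact Finset.mem_map_of_mem _ ((memJ _).2 rfl)
      rw [← EI.apply_symm_apply (τ _), memI] at this
      obtain ⟨v, hv⟩ := Sum.isLeft_iff.1 this
      exact ⟨v, hv.symm⟩
    obtain ⟨⟨a, b⟩, hab⟩ := Equiv.Perm.mem_sumCongrHom_range_of_perm_mapsTo_inl hmap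
    refine ⟨(a, b), Finset.mem_univ _, ?_⟩
    have hab' : Equiv.Perm.sumCongr a b = EJ.trans (τ.trans EI.symm) := hab
    ext y
    simp [hab']
  · rintro ⟨a, b⟩ -
    -- In the increasing enumerations the bijection is the inverse shuffle of `J`, then `a ⊕ b`,
    -- then the shuffle of `I`.
    have hsign : Equiv.Perm.sign ((eβ.toEquiv.trans
        (EJ.symm.trans ((Equiv.Perm.sumCongr a b).trans EI))).trans eα.symm.toEquiv)
        = shuffleSign I * shuffleSign J * (Equiv.Perm.sign a * Equiv.Perm.sign b) := by
      rw [shuffleSign_eq_sign I hI hIc eα, shuffleSign_eq_sign J hJ hJc eβ,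
        ← Equiv.Perm.sign_sumCongr a b,
        ← Equiv.Perm.sign_permCongr finSumFinEquiv (Equiv.Perm.sumCongr a b),
        ← Equiv.Perm.sign_inv (Equiv.trans (Equiv.trans finSumFinEquiv.symm
          (finSumEquivOfFinset hJ hJc)) _), mul_assoc,
        mul_comm (Equiv.Perm.sign (_)⁻¹), ← Equiv.Perm.sign_mul, ← Equiv.Perm.sign_mul]
      congr 1
      ext x
      simp [Equiv.Perm.inv_def, hEI, hEJ, Equiv.permCongr_apply]
    have hA : ∏ y ∈ J, A (EI ((Equiv.Perm.sumCongr a b) (EJ.symm y))) y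
        = ∏ x, A (I.orderEmbOfFin hI (a x)) (J.orderEmbOfFin hJ x) := by
      conv_lhs => rw [← Finset.map_orderEmbOfFin_univ J hJ, Finset.prod_map]
      refine Finset.prod_congr rfl fun x _ => ?_
      have : J.orderEmbOfFin hJ x = EJ (Sum.inl x) := rfl
      simp [this, hEI]
    have hB : ∏ y ∈ Jᶜ, B (EI ((Equiv.Perm.sumCongr a b) (EJ.symm y))) y
        = ∏ x, B (Iᶜ.orderEmbOfFin hIc (b x)) (Jᶜ.orderEmbOfFin hJc x) := by
      conv_lhs => rw [← Finset.map_orderEmbOfFin_univ Jᶜ hJc, Finset.prod_map]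
      refine Finset.prod_congr rfl fun x _ => ?_
      have : Jᶜ.orderEmbOfFin hJc x = EJ (Sum.inr x) := rfl
      simp [this, hEI]
    simp only [Equiv.trans_apply, Matrix.submatrix_apply]
    rw [hsign, hA, hB]
    push_cast
    ring

/-- Multiply out `∏ (A + B)` over the set `J` of columns where `A` is chosen, then group the
bijections by the image `I` of `J`. -/
theorem det_add_submatrix_orderIso [dα : DecidableEq α] [dβ : DecidableEq β] {n : ℕ}
    (A B : Matrix α β R) (eα : Fin n ≃o α) (eβ : Fin n ≃o β) :
    ((A + B).submatrix eα eβ).det = ∑ k ∈ Finset.range (n + 1),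
      ∑ I ∈ Finset.powersetCard k (Finset.univ : Finset α),
        ∑ J ∈ Finset.powersetCard k (Finset.univ : Finset β),
          ((shuffleSign I : ℤ) : R) * ((shuffleSign J : ℤ) : R) * minorDet A I J *
            minorDet B Iᶜ Jᶜ := by
  obtain rfl : dα = LinearOrder.toDecidableEq := Subsingleton.elim _ _
  obtain rfl : dβ = LinearOrder.toDecidableEq := Subsingleton.elim _ _
  have hcard : (Finset.univ : Finset β).card = n := by
    rw [Finset.card_univ, ← Fintype.card_congr eβ.toEquiv, Fintype.card_fin]
  rw [det_submatrix_orderIso]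
  simp only [Matrix.add_apply, Finset.prod_add, Finset.mul_sum]
  rw [Finset.sum_comm, Finset.sum_powerset, hcard]
  refine Finset.sum_congr rfl fun k _ => ?_
  rw [Finset.sum_comm (s := Finset.powersetCard k (Finset.univ : Finset α))]
  refine Finset.sum_congr rfl fun J hJ => ?_
  rw [← Finset.sum_fiberwise Finset.univ fun τ : β ≃ α => J.map τ.toEmbedding]
  have hJ' := (Finset.mem_powersetCard.1 hJ).2
  symm
  refine (Finset.sum_congr rfl fun I hI => ?_).trans
    (Finset.sum_subset (Finset.subset_univ _) fun I _ hI => ?_)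
  · rw [← sum_equiv_fiber A B eα eβ I J (Finset.mem_powersetCard.1 hI).2 hJ']
    simp only [← Finset.compl_eq_univ_sdiff]
  · rw [Finset.filter_false_of_mem, Finset.sum_empty]
    rintro τ - rfl
    exact hI (Finset.mem_powersetCard.2 ⟨Finset.subset_univ _, by rw [Finset.card_map, hJ']⟩)

end Laplace

/-! ### Symmetric matrices and differential forms -/

theorem mem_symPairs {g : ℕ} {p : Fin g × Fin g} : p ∈ symPairs g ↔ p.1 ≤ p.2 := by
  rcases p with ⟨i, j⟩
  simp [symPairs]

theorem nodup_symPairs (g : ℕ) : (symPairs g).Nodup := by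
  unfold symPairs
  rw [List.nodup_flatMap]
  refine ⟨fun i _ => ((List.nodup_finRange g).filter _).map fun a b h => (Prod.mk.inj h).2, ?_⟩
  refine (List.nodup_finRange g).imp fun {a b} hab => ?_
  rw [Function.onFun, List.disjoint_left]
  intro p hp hq
  obtain ⟨_, _, rfl⟩ := List.mem_map.1 hp
  obtain ⟨_, _, h⟩ := List.mem_map.1 hq
  exact hab (Prod.mk.inj h).1.symm

theorem isSymm_coordVec {g : ℕ} (i j : Fin g) : (coordVec i j).IsSymm := by
  ext a b
  simp only [coordVec, Matrix.transpose_apply, Matrix.of_apply]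
  congr 1
  apply propext
  tauto

/-- The determinant of the values on the coordinate vectors is an alternating form on the dual
space, and it takes the value `1` on the coordinate functions. -/
theorem topForm_ne_zero (g : ℕ) : topForm g ≠ 0 := by
  set L := symPairs g with hL
  let E : Fin L.length → symMatrices g := fun b => ⟨coordVec (L.get b).1 (L.get b).2,
    isSymm_coordVec _ _⟩
  let φ : Module.Dual ℂ (symMatrices g) →ₗ[ℂ] (Fin L.length → ℂ) :=
    LinearMap.pi fun b => Module.Dual.eval ℂ _ (E b)
  -- A linear form on the exterior algebra needs an alternating map in every degree; all but the top
  -- one are zero.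
  let f : ∀ n, (Module.Dual ℂ (symMatrices g)) [⋀^Fin n]→ₗ[ℂ] ℂ := fun n =>
    if h : n = L.length then h ▸ Matrix.detRowAlternating.compLinearMap φ else 0
  have h1 : topForm g = ExteriorAlgebra.ιMulti ℂ L.length
      fun a => coord (L.get a).1 (L.get a).2 := by
    rw [ExteriorAlgebra.ιMulti_apply, topForm, ← hL]
    conv_lhs => rw [← List.ofFn_get L, List.map_ofFn]
    rfl
  intro h0
  have h2 := congrArg (ExteriorAlgebra.liftAlternating f) h0
  rw [h1, ExteriorAlgebra.liftAlternating_apply_ιMulti, map_zero] at h2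
  simp only [f, dif_pos rfl] at h2
  have h3 : (fun a => φ (coord (L.get a).1 (L.get a).2)) = (1 : Matrix _ _ ℂ) := by
    ext a b
    simp only [φ, E, LinearMap.pi_apply, Module.Dual.eval_apply, coord, LinearMap.comp_apply,
      Submodule.subtype_apply, Matrix.entryLinearMap_apply, coordVec, Matrix.of_apply,
      Matrix.one_apply]
    congr 1
    apply propext
    constructor
    · have ha := mem_symPairs.1 (L.get_mem a)
      have hb := mem_symPairs.1 (L.get_mem b)
      intro h
      refine (List.nodup_iff_injective_get.1 (nodup_symPairs g)) (Prod.ext ?_ ?_)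
      · rcases h with h | h
        · exact h.1
        · rw [h.1, h.2] at ha
          exact h.1.trans (le_antisymm ha hb)
      · rcases h with h | h
        · exact h.2
        · rw [h.1, h.2] at ha
          exact h.2.trans (le_antisymm hb ha)
    · rintro rfl
      exact Or.inl ⟨rfl, rfl⟩
  rw [AlternatingMap.compLinearMap_apply] at h2
  change Matrix.det (fun a => φ (coord (L.get a).1 (L.get a).2)) = 0 at h2
  rw [h3, Matrix.det_one] at h2
  exact one_ne_zero h2

theorem dtau_mul_self {g : ℕ} (p : Fin g × Fin g) : dtau p * dtau p = 0 :=
  ExteriorAlgebra.ι_sq_zero _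

theorem prod_map_dtau_mul_of_mem {g : ℕ} (l : List (Fin g × Fin g)) {p : Fin g × Fin g}
    (hp : p ∈ l) : (l.map dtau).prod * dtau p = 0 := by
  rw [← sign_erase_mul_dtau l p hp, mul_assoc, dtau_mul_self, mul_zero]

theorem dtauCheck_mul_dtau_eq {g : ℕ} (i j h k : Fin g) (hhk : h ≤ k) :
    dtauCheck i j * dtau (h, k)
      = if (i = h ∧ j = k) ∨ (i = k ∧ j = h) then topForm g else 0 := by
  have hcomm : dtauCheck i j = dtauCheck (min i j) (max i j) := by
    unfold dtauCheck
    rw [min_eq_left min_le_max, max_eq_right min_le_max]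
  rw [hcomm]
  split_ifs with hc
  · have : min i j = h ∧ max i j = k := by
      rcases hc with ⟨rfl, rfl⟩ | ⟨rfl, rfl⟩
      · exact ⟨min_eq_left hhk, max_eq_right hhk⟩
      · exact ⟨min_eq_right hhk, max_eq_left hhk⟩
    rw [this.1, this.2, dtauCheck_mul_dtau _ _ hhk]
  · unfold dtauCheck
    rw [mul_assoc, prod_map_dtau_mul_of_mem, mul_zero]
    rw [(nodup_symPairs g).mem_erase_iff, mem_symPairs]
    refine ⟨fun he => hc ?_, hhk⟩
    rw [min_eq_left min_le_max, max_eq_right min_le_max] at he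
    obtain ⟨rfl, rfl⟩ := Prod.mk.inj he
    rcases le_total i j with hij | hij
    · exact Or.inl ⟨(min_eq_left hij).symm, (max_eq_right hij).symm⟩
    · exact Or.inr ⟨(max_eq_left hij).symm, (min_eq_right hij).symm⟩

theorem traceForm_sub {g : ℕ} (B C : Matrix (Fin g) (Fin g) ℂ) :
    traceForm (B - C) = traceForm B - traceForm C := by
  simp [traceForm, sub_smul, Finset.sum_sub_distrib]

theorem traceForm_smul {g : ℕ} (c : ℂ) (B : Matrix (Fin g) (Fin g) ℂ) :
    traceForm (c • B) = c • traceForm B := by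
  simp [traceForm, Finset.smul_sum, smul_smul]

/-- Wedging with `dτ_{ab}` isolates `B a a` on the diagonal and `B a b + B b a` off it, times the
nonzero top form. Symmetry turns the latter into `2 B a b`. -/
theorem eq_zero_of_traceForm_eq_zero {g : ℕ} {B : Matrix (Fin g) (Fin g) ℂ} (hB : B.IsSymm)
    (h : traceForm B = 0) : B = 0 := by
  have key : ∀ a b : Fin g, a ≤ b → B a b = 0 := fun a b hab => by
    have h1 := congrArg (· * dtau (a, b)) h
    simp only [traceForm, Finset.sum_mul, smul_mul_assoc, dtauCheck_mul_dtau_eq _ _ a b hab,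
      zero_mul] at h1
    by_cases hne : a = b
    · subst hne
      rw [Finset.sum_eq_single a, Finset.sum_eq_single a] at h1
      · simpa [topForm_ne_zero] using h1
      · intro j _ hj; simp [hj]
      · simp
      · intro i _ hi; simp [hi]
      · simp
    · have hc : ∀ i j, B i j • (if (i = a ∧ j = b) ∨ (i = b ∧ j = a) then topForm g else 0)
          = (if i = a then if j = b then B a b • topForm g else 0 else 0)
            + (if i = b then if j = a then B b a • topForm g else 0 else 0) := fun i j => by
        have hne' : b ≠ a := fun h => hne h.symm
        by_cases hia : i = a
        · subst hia; by_cases h2 : j = b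
          · subst h2; simp [hne]
          · simp [h2, hne]
        · by_cases h3 : i = b
          · subst h3; by_cases h4 : j = a
            · subst h4; simp [hia]
            · simp [hia, h4]
          · simp [hia, h3]
      simp only [hc, Finset.sum_add_distrib, Finset.sum_ite_eq', Finset.mem_univ, if_true,
        Finset.sum_ite_irrel, Finset.sum_const_zero] at h1
      rw [hB.apply a b, ← add_smul, smul_eq_zero] at h1
      have := h1.resolve_right (topForm_ne_zero g)
      rwa [← two_mul, mul_eq_zero, or_iff_right two_ne_zero] at this
  ext a b
  rcases le_total a b with hab | hab
  · exact key a b hab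
  · rw [← hB.apply]; exact key b a hab

theorem traceForm_injective {g : ℕ} {B C : Matrix (Fin g) (Fin g) ℂ} (hB : B.IsSymm)
    (hC : C.IsSymm) (h : traceForm B = traceForm C) : B = C :=
  sub_eq_zero.1 (eq_zero_of_traceForm_eq_zero (hB.sub hC) (by rw [traceForm_sub, h, sub_self]))

/-! ### Sums over tuples and minors of sums of rank one matrices -/

/-- In the determinant of a sum of `n` matrices of rank one only the injective assignments of
summands to columns contribute. -/
theorem sum_sign_mul_tsum_prod {X : Type*} {k n : ℕ} (x y : Fin k → X → ℂ) (t : X → ℂ)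
    (hs : ∀ (S : Finset (Fin k)) (s : Equiv.Perm (Fin k)),
      Summable fun p => ‖(∏ c ∈ S, x (s c) p * y c p) * t p‖) :
    ∑ s : Equiv.Perm (Fin k), ((Equiv.Perm.sign s : ℤ) : ℂ) *
        ∑' P : Fin n → X, (∏ c, ∑ a, x (s c) (P a) * y c (P a)) * ∏ a, t (P a)
      = n.descFactorial k * (∑' p, t p) ^ (n - k) *
        (Matrix.of fun i j => ∑' p, x i p * y j p * t p).det := by
  classical
  -- `φ` records which summand each column uses. Collecting the factors that involve the same
  -- variable `P a` makes the sum over `P` a product of `n` single sums.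
  have hterm : ∀ (s : Equiv.Perm (Fin k)) (φ : Fin k → Fin n) (P : Fin n → X),
      (∏ c, x (s c) (P (φ c)) * y c (P (φ c))) * ∏ a, t (P a)
        = ∏ a, (∏ c with φ c = a, x (s c) (P a) * y c (P a)) * t (P a) := fun s φ P => by
    rw [Finset.prod_mul_distrib (g := fun a => t (P a)), ← Finset.prod_fiberwise Finset.univ φ]
    congr 1
    refine Finset.prod_congr rfl fun a _ => Finset.prod_congr rfl fun c hc => ?_
    rw [(Finset.mem_filter.1 hc).2]
  have hpi := fun (s : Equiv.Perm (Fin k)) (φ : Fin k → Fin n) =>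
    summable_norm_prod_pi
      (fun a p => (∏ c with φ c = a, x (s c) p * y c p) * t p) fun a => hs _ s
  have hsum : ∀ (s : Equiv.Perm (Fin k)) (φ : Fin k → Fin n), Summable fun P : Fin n → X =>
      (∏ c, x (s c) (P (φ c)) * y c (P (φ c))) * ∏ a, t (P a) := fun s φ => by
    simp only [hterm]
    exact (hpi s φ).1.of_norm
  have hexp : ∀ s : Equiv.Perm (Fin k),
      ∑' P : Fin n → X, (∏ c, ∑ a, x (s c) (P a) * y c (P a)) * ∏ a, t (P a)
        = ∑ φ : Fin k → Fin n, ∑' P : Fin n → X,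
          (∏ c, x (s c) (P (φ c)) * y c (P (φ c))) * ∏ a, t (P a) := fun s => by
    rw [← Summable.tsum_finsetSum fun φ _ => hsum s φ]
    refine tsum_congr fun P => ?_
    rw [Finset.prod_univ_sum, Finset.sum_mul, Fintype.piFinset_univ]
  simp only [hexp, Finset.mul_sum]
  rw [Finset.sum_comm]
  -- For fixed `P` the factors `y` and `t` do not depend on `s`, and the signed sum of the
  -- `x`-products is a determinant with two equal columns.
  have hnoninj : ∀ φ : Fin k → Fin n, ¬ Function.Injective φ →
      ∑ s : Equiv.Perm (Fin k), ((Equiv.Perm.sign s : ℤ) : ℂ) *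
        ∑' P : Fin n → X, (∏ c, x (s c) (P (φ c)) * y c (P (φ c))) * ∏ a, t (P a) = 0 :=
    fun φ hφ => by
    simp only [← tsum_mul_left]
    rw [← Summable.tsum_finsetSum fun s _ => (hsum s φ).mul_left _]
    refine (tsum_congr fun P => ?_).trans tsum_zero
    have hdet : (Matrix.of fun i c => x i (P (φ c))).det = 0 := by
      rw [Function.Injective] at hφ
      push Not at hφ
      obtain ⟨c, d, hcd, hne⟩ := hφ
      exact Matrix.det_zero_of_column_eq hne fun i => by simp [hcd]
    rw [Matrix.det_apply'] at hdet
    have h2 := congrArg (· * ((∏ c, y c (P (φ c))) * ∏ a, t (P a))) hdet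
    simp only [zero_mul, Finset.sum_mul, Matrix.of_apply] at h2
    rw [← h2]
    refine Finset.sum_congr rfl fun s _ => ?_
    rw [Finset.prod_mul_distrib]
    ring
  -- Each column now has its own variable; the `n - k` unused variables each contribute `∑ t`.
  have hinj : ∀ φ : Fin k → Fin n, Function.Injective φ → ∀ s : Equiv.Perm (Fin k),
      ∑' P : Fin n → X, (∏ c, x (s c) (P (φ c)) * y c (P (φ c))) * ∏ a, t (P a)
        = (∑' p, t p) ^ (n - k) * ∏ c, ∑' p, x (s c) p * y c p * t p := fun φ hφ s => by
    simp only [hterm]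
    rw [(hpi s φ).2, ← Finset.prod_mul_prod_compl (Finset.univ.image φ),
      Finset.prod_image hφ.injOn, mul_comm]
    congr 1
    · rw [Finset.prod_congr rfl (g := fun _ => ∑' p, t p), Finset.prod_const,
        Finset.card_compl, Finset.card_image_of_injective _ hφ]
      · simp
      · intro a ha
        have : Finset.univ.filter (fun c => φ c = a) = ∅ := by
          ext c
          simp only [Finset.mem_compl, Finset.mem_image, Finset.mem_univ, true_and,
            not_exists] at ha
          simp [ha c]
        simp [this]
    · refine Finset.prod_congr rfl fun d _ => ?_
      have : Finset.univ.filter (fun c => φ c = φ d) = {d} := by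
        ext c
        simp [hφ.eq_iff]
      simp [this]
  rw [← Finset.sum_filter_add_sum_filter_not Finset.univ fun φ : Fin k → Fin n =>
    Function.Injective φ, Finset.sum_eq_zero (s := Finset.univ.filter fun φ =>
      ¬ Function.Injective φ) fun φ hφ => hnoninj φ (Finset.mem_filter.1 hφ).2, add_zero,
    Finset.sum_congr rfl (g := fun _ => (∑' p, t p) ^ (n - k) *
      (Matrix.of fun i j => ∑' p, x i p * y j p * t p).det), Finset.sum_const, nsmul_eq_mul,
    ← mul_assoc]
  · congr 3
    rw [← Fintype.card_subtype, Fintype.card_congr (Equiv.subtypeInjectiveEquivEmbedding _ _),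
      Fintype.card_embedding_eq, Fintype.card_fin, Fintype.card_fin]
  · intro φ hφ
    rw [Matrix.det_apply', Finset.mul_sum]
    refine Finset.sum_congr rfl fun s _ => ?_
    rw [hinj φ (Finset.mem_filter.1 hφ).2 s]
    simp only [Matrix.of_apply]
    ring

/-! ### Differentiation of exponential series in `τ` -/

/-- The exponential `exp (2πi tr (M τ))`, for symmetric `M`. -/
def quadExp {g : ℕ} (M : Matrix (Fin g) (Fin g) ℝ) (τ : Matrix (Fin g) (Fin g) ℂ) : ℂ :=
  Complex.exp (2 * Real.pi * Complex.I * ∑ i, ∑ j, (M i j : ℂ) * τ i j)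

theorem quadExp_add_smul {g : ℕ} (M : Matrix (Fin g) (Fin g) ℝ)
    (τ V : Matrix (Fin g) (Fin g) ℂ) (t : ℂ) :
    quadExp M (τ + t • V) =
      Complex.exp (t * (2 * Real.pi * Complex.I * ∑ i, ∑ j, (M i j : ℂ) * V i j)) *
        quadExp M τ := by
  unfold quadExp
  rw [← Complex.exp_add]
  congr 1
  simp only [Finset.mul_sum, ← Finset.sum_add_distrib]
  refine Finset.sum_congr rfl fun i _ => Finset.sum_congr rfl fun j _ => ?_
  rw [Matrix.add_apply, Matrix.smul_apply, smul_eq_mul]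
  ring

section Series

variable {X : Type*} {g : ℕ} {N : X → ℝ} {M : X → Matrix (Fin g) (Fin g) ℝ}

theorem hasLineDerivAt_tsum_quadExp {w : X → ℂ} {τ : Matrix (Fin g) (Fin g) ℂ}
    (hN : ∀ x, 0 ≤ N x) (hM : ∀ x i j, |M x i j| ≤ N x)
    (h : RapidDecay N fun x => w x * quadExp (M x) τ) (V : Matrix (Fin g) (Fin g) ℂ) :
    HasLineDerivAt ℂ (fun τ => ∑' x, w x * quadExp (M x) τ)
      (∑' x, (2 * Real.pi * Complex.I * ∑ i, ∑ j, (M x i j : ℂ) * V i j) *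
        (w x * quadExp (M x) τ)) τ V := by
  have hb : ∀ x, ‖2 * Real.pi * Complex.I * ∑ i, ∑ j, (M x i j : ℂ) * V i j‖
      ≤ (2 * Real.pi * ∑ i, ∑ j, ‖V i j‖) * N x := fun x => by
    have h1 : ‖∑ i, ∑ j, (M x i j : ℂ) * V i j‖ ≤ (∑ i, ∑ j, ‖V i j‖) * N x := by
      rw [Finset.sum_mul]
      refine norm_sum_le_of_le _ fun i _ => ?_
      rw [Finset.sum_mul]
      refine norm_sum_le_of_le _ fun j _ => ?_
      rw [norm_mul, mul_comm, Complex.norm_real, Real.norm_eq_abs]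
      exact mul_le_mul_of_nonneg_left (hM x i j) (norm_nonneg _)
    have h2 : ‖(2 * Real.pi * Complex.I : ℂ)‖ = 2 * Real.pi := by
      simp [abs_of_pos Real.pi_pos]
    rw [norm_mul, h2, mul_assoc (2 * Real.pi)]
    exact mul_le_mul_of_nonneg_left h1 (by positivity)
  have := h.hasDerivAt hN hb
  unfold HasLineDerivAt
  refine this.congr_of_eventuallyEq (Filter.Eventually.of_forall fun t => ?_)
  refine tsum_congr fun x => ?_
  rw [quadExp_add_smul]
  ring

/-- Off the diagonal `∂/∂τ_{ij}` meets both `M i j` and `M j i`; the factor `½ (1 + δ_{ij})`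
compensates for this double count. -/
theorem sum_mul_coordVec {M : Matrix (Fin g) (Fin g) ℝ} (hM : M.IsSymm) (i j : Fin g) :
    (1 + if i = j then 1 else 0) / 2 * ∑ a, ∑ b, (M a b : ℂ) * coordVec i j a b = M i j := by
  by_cases hij : i = j
  · subst hij
    have : ∀ a b, (M a b : ℂ) * coordVec i i a b = if a = i then
        if b = i then (M i i : ℂ) else 0 else 0 := fun a b => by
      by_cases ha : a = i <;> by_cases hb : b = i <;> simp [coordVec, ha, hb]
    simp only [this, Finset.sum_ite_eq', Finset.mem_univ, if_true, Finset.sum_ite_irrel,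
      Finset.sum_const_zero]
    norm_num
  · have : ∀ a b, (M a b : ℂ) * coordVec i j a b
        = (if a = i then if b = j then (M i j : ℂ) else 0 else 0)
          + (if a = j then if b = i then (M j i : ℂ) else 0 else 0) := fun a b => by
      have hji : ¬ j = i := fun h => hij h.symm
      by_cases ha : a = i
      · subst ha
        by_cases hb : b = j
        · subst hb; simp [coordVec, hij]
        · simp [coordVec, hb, hij]
      · by_cases ha' : a = j
        · subst ha'
          by_cases hb : b = i
          · subst hb; simp [coordVec, hji]
          · simp [coordVec, hb, hji]
        · simp [coordVec, ha, ha']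
    simp only [this, Finset.sum_add_distrib, Finset.sum_ite_eq', Finset.mem_univ, if_true,
      Finset.sum_ite_irrel, Finset.sum_const_zero]
    rw [hM.apply i j, if_neg hij]
    ring

theorem del_tsum_quadExp {w : X → ℂ} {τ : Matrix (Fin g) (Fin g) ℂ}
    (hN : ∀ x, 0 ≤ N x) (hM : ∀ x i j, |M x i j| ≤ N x) (hsymm : ∀ x, (M x).IsSymm)
    (h : RapidDecay N fun x => w x * quadExp (M x) τ) (i j : Fin g) :
    del i j (fun τ => ∑' x, w x * quadExp (M x) τ) τ
      = ∑' x, 2 * Real.pi * Complex.I * M x i j * w x * quadExp (M x) τ := by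
  rw [del, (hasLineDerivAt_tsum_quadExp hN hM h _).lineDeriv, ← tsum_mul_left]
  refine tsum_congr fun x => ?_
  rw [← sum_mul_coordVec (hsymm x) i j]
  ring

theorem del_congr_of_eqOn {f f' : Matrix (Fin g) (Fin g) ℂ → ℂ}
    (hf : ∀ τ ∈ convDomain g, f τ = f' τ) {τ : Matrix (Fin g) (Fin g) ℂ}
    (hτ : τ ∈ convDomain g) (i j : Fin g) : del i j f τ = del i j f' τ := by
  unfold del lineDeriv
  congr 1
  refine Filter.EventuallyEq.deriv_eq ?_
  filter_upwards [eventually_mem_convDomain hτ (coordVec i j)] with t ht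
  exact hf _ ht

/-- Each operator contributes a factor `2πi M_{ij}` to every term. The decay is carried through the
induction because it licenses the next derivative. -/
theorem foldr_del_tsum_quadExp (hN : ∀ x, 0 ≤ N x) (hM : ∀ x i j, |M x i j| ≤ N x)
    (hsymm : ∀ x, (M x).IsSymm)
    (hdec : ∀ τ ∈ convDomain g, RapidDecay N fun x => quadExp (M x) τ)
    {f : Matrix (Fin g) (Fin g) ℂ → ℂ} (hf : ∀ τ ∈ convDomain g, f τ = ∑' x, quadExp (M x) τ)
    (l : List (Fin g × Fin g)) (τ : Matrix (Fin g) (Fin g) ℂ) (hτ : τ ∈ convDomain g) :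
    l.foldr (fun p F => del p.1 p.2 F) f τ
        = ∑' x, (l.map fun p => 2 * Real.pi * Complex.I * (M x p.1 p.2 : ℂ)).prod *
          quadExp (M x) τ ∧
      RapidDecay N fun x => (l.map fun p => 2 * Real.pi * Complex.I * (M x p.1 p.2 : ℂ)).prod *
          quadExp (M x) τ := by
  induction l generalizing τ with
  | nil => simpa using ⟨hf τ hτ, hdec τ hτ⟩
  | cons p l ih =>
    constructor
    · rw [List.foldr_cons, del_congr_of_eqOn (fun τ hτ => (ih τ hτ).1) hτ,
        del_tsum_quadExp hN hM hsymm (ih τ hτ).2]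
      rfl
    · have := (ih τ hτ).2.mul_of_norm_le (C := 2 * Real.pi) hN
        (b := fun x => 2 * Real.pi * Complex.I * (M x p.1 p.2 : ℂ)) fun x => by
          have h2 : ‖(2 * Real.pi * Complex.I : ℂ)‖ = 2 * Real.pi := by
            simp [abs_of_pos Real.pi_pos]
          rw [norm_mul, h2, Complex.norm_real, Real.norm_eq_abs]
          exact mul_le_mul_of_nonneg_left (hM x _ _) (by positivity)
      simpa only [List.map_cons, List.prod_cons, mul_assoc] using this

end Series

/-! ### Theta constants -/

section Theta

variable {g : ℕ} (σ : Fin g → ZMod 2)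

/-- The symmetric matrix `∑ₐ qₐ qₐᵗ` with `qₐ = pₐ + σ / 2`. -/
def gram {n : ℕ} (P : Fin n → Fin g → ℤ) : Matrix (Fin g) (Fin g) ℝ :=
  Matrix.of fun i j => ∑ a, shiftVec σ (P a) i * shiftVec σ (P a) j

theorem isSymm_gram {n : ℕ} (P : Fin n → Fin g → ℤ) : (gram σ P).IsSymm := by
  ext i j
  simp only [gram, Matrix.transpose_apply, Matrix.of_apply]
  exact Finset.sum_congr rfl fun a _ => mul_comm _ _

theorem abs_gram_le {n : ℕ} (P : Fin n → Fin g → ℤ) (i j : Fin g) :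
    |gram σ P i j| ≤ ∑ a, shiftWeight σ (P a) := by
  rw [gram, Matrix.of_apply]
  exact (Finset.abs_sum_le_sum_abs _ _).trans
    (Finset.sum_le_sum fun a _ => abs_shiftVec_mul_le σ (P a) i j)

theorem quadExp_gram {n : ℕ} (P : Fin n → Fin g → ℤ) (τ : Matrix (Fin g) (Fin g) ℂ) :
    quadExp (gram σ P) τ = ∏ a, thetaTerm σ τ 0 (P a) := by
  simp only [thetaTerm, Pi.zero_apply, mul_zero, Finset.sum_const_zero, add_zero]
  rw [← Complex.exp_sum, quadExp, ← Finset.mul_sum]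
  congr 2
  rw [Finset.sum_comm (s := (Finset.univ : Finset (Fin n)))]
  refine Finset.sum_congr rfl fun i _ => ?_
  rw [Finset.sum_comm]
  refine Finset.sum_congr rfl fun j _ => ?_
  rw [← Finset.sum_mul, gram, Matrix.of_apply]
  push_cast
  rfl

theorem sum_shiftWeight_nonneg {n : ℕ} (P : Fin n → Fin g → ℤ) :
    0 ≤ ∑ a, shiftWeight σ (P a) :=
  Finset.sum_nonneg fun a _ => shiftWeight_nonneg σ (P a)

theorem rapidDecay_quadExp_gram {n : ℕ} {τ : Matrix (Fin g) (Fin g) ℂ}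
    (hτ : τ ∈ convDomain g) :
    RapidDecay (fun P : Fin n → Fin g → ℤ => ∑ a, shiftWeight σ (P a))
      fun P => quadExp (gram σ P) τ := by
  simp only [quadExp_gram]
  exact (rapidDecay_thetaTerm σ hτ 0).prod

theorem thetaConst_eq_tsum (τ : Matrix (Fin g) (Fin g) ℂ) :
    thetaConst σ τ = ∑' p, thetaTerm σ τ 0 p := thetaTwo_eq_tsum σ τ 0

/-- The product of `n` absolutely convergent series is one series over `n`-tuples, and the exponents
add up to the Gram matrix. -/
theorem thetaConst_pow_eq_tsum (n : ℕ) {τ : Matrix (Fin g) (Fin g) ℂ} (hτ : τ ∈ convDomain g) :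
    (thetaConst σ ^ n) τ = ∑' P : Fin n → Fin g → ℤ, quadExp (gram σ P) τ := by
  simp only [quadExp_gram]
  rw [(summable_norm_prod_pi (fun _ => thetaTerm σ τ 0) fun _ =>
    (rapidDecay_thetaTerm σ hτ 0).summable_norm (shiftWeight_nonneg σ)).2]
  simp [thetaConst_eq_tsum]

theorem thetaConst_eq_tsum_quadExp :
    thetaConst σ = fun τ => ∑' p : Fin g → ℤ,
      (1 : ℂ) * quadExp (gram σ fun _ : Fin 1 => p) τ := by
  funext τ
  rw [thetaConst_eq_tsum]
  refine tsum_congr fun p => ?_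
  rw [quadExp_gram]
  simp

theorem rapidDecay_quadExp_gram_one {τ : Matrix (Fin g) (Fin g) ℂ} (hτ : τ ∈ convDomain g) :
    RapidDecay (shiftWeight σ)
      fun p => (1 : ℂ) * quadExp (gram σ fun _ : Fin 1 => p) τ := by
  simp only [quadExp_gram, Finset.univ_unique, Finset.prod_singleton, one_mul]
  exact rapidDecay_thetaTerm σ hτ 0

theorem lineDifferentiableAt_thetaConst {τ : Matrix (Fin g) (Fin g) ℂ} (hτ : τ ∈ convDomain g)
    (V : Matrix (Fin g) (Fin g) ℂ) : LineDifferentiableAt ℂ (thetaConst σ) τ V := by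
  rw [thetaConst_eq_tsum_quadExp]
  exact (hasLineDerivAt_tsum_quadExp (shiftWeight_nonneg σ)
    (fun p i j => by simpa using abs_gram_le σ (fun _ : Fin 1 => p) i j)
    (rapidDecay_quadExp_gram_one σ hτ) V).lineDifferentiableAt

theorem del_thetaConst {τ : Matrix (Fin g) (Fin g) ℂ} (hτ : τ ∈ convDomain g) (i j : Fin g) :
    del i j (thetaConst σ) τ = ∑' p, (shiftVec σ p i : ℂ) *
      (2 * Real.pi * Complex.I * shiftVec σ p j) * thetaTerm σ τ 0 p := by
  rw [thetaConst_eq_tsum_quadExp, del_tsum_quadExp (shiftWeight_nonneg σ)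
    (fun p i j => by simpa using abs_gram_le σ (fun _ : Fin 1 => p) i j)
    (fun p => isSymm_gram σ _) (rapidDecay_quadExp_gram_one σ hτ)]
  refine tsum_congr fun p => ?_
  rw [quadExp_gram]
  simp only [gram, Matrix.of_apply, Finset.univ_unique, Finset.sum_singleton,
    Finset.prod_singleton]
  push_cast
  ring

theorem rapidDecay_prod_mul_thetaTerm {τ : Matrix (Fin g) (Fin g) ℂ} (hτ : τ ∈ convDomain g)
    {k : ℕ} (r r' : Fin k → Fin g) (S : Finset (Fin k)) :
    RapidDecay (shiftWeight σ) fun p => (∏ c ∈ S, (shiftVec σ p (r c) : ℂ) *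
      (2 * Real.pi * Complex.I * shiftVec σ p (r' c))) * thetaTerm σ τ 0 p := by
  classical
  induction S using Finset.induction_on with
  | empty => simpa using rapidDecay_thetaTerm σ hτ 0
  | insert c S hc ih =>
    have := ih.mul_of_norm_le (C := 2 * Real.pi) (shiftWeight_nonneg σ)
      (b := fun p => (shiftVec σ p (r c) : ℂ) *
        (2 * Real.pi * Complex.I * shiftVec σ p (r' c))) fun p => by
        have h2 : (shiftVec σ p (r c) : ℂ) * (2 * Real.pi * Complex.I * shiftVec σ p (r' c))
            = (2 * Real.pi * Complex.I) * ((shiftVec σ p (r c) * shiftVec σ p (r' c) : ℝ) : ℂ) := by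
          push_cast; ring
        have h3 : ‖(2 * Real.pi * Complex.I : ℂ)‖ = 2 * Real.pi := by
          simp [abs_of_pos Real.pi_pos]
        rw [h2, norm_mul, h3, Complex.norm_real, Real.norm_eq_abs]
        exact mul_le_mul_of_nonneg_left (abs_shiftVec_mul_le σ p _ _) (by positivity)
    simpa only [Finset.prod_insert hc, mul_assoc] using this

/-- The minors of `∂` applied to a power of a theta constant. -/
theorem delMinor_thetaConst_pow (n : ℕ) {k : ℕ} {τ : Matrix (Fin g) (Fin g) ℂ}
    (hτ : τ ∈ convDomain g) {I J : Finset (Fin g)} (hI : I.card = k) (hJ : J.card = k) :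
    delMinor I J (thetaConst σ ^ n) τ = n.descFactorial k * thetaConst σ τ ^ (n - k) *
      minorDet (delMatrix (thetaConst σ) τ) I J := by
  subst hI
  rw [delMinor, dif_pos hJ, minorDet_eq _ rfl hJ]
  set r := I.orderEmbOfFin rfl
  set r' := J.orderEmbOfFin hJ
  have hdet : (delMatrix (thetaConst σ) τ).submatrix r r'
      = Matrix.of fun i j => ∑' p, (shiftVec σ p (r i) : ℂ) *
        (2 * Real.pi * Complex.I * shiftVec σ p (r' j)) * thetaTerm σ τ 0 p := by
    ext i j
    simp only [Matrix.submatrix_apply, delMatrix, Matrix.of_apply]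
    exact del_thetaConst σ hτ _ _
  -- The constant `2πi` is put into the column factor, so that each lattice point contributes a
  -- matrix of rank one.
  rw [hdet, thetaConst_eq_tsum, ← sum_sign_mul_tsum_prod
    (fun i p => (shiftVec σ p (r i) : ℂ))
    (fun j p => 2 * Real.pi * Complex.I * (shiftVec σ p (r' j) : ℂ)) (thetaTerm σ τ 0)
    fun S s => (rapidDecay_prod_mul_thetaTerm σ hτ (fun c => r (s c)) r' S).summable_norm
      (shiftWeight_nonneg σ)]
  refine Finset.sum_congr rfl fun s _ => ?_
  congr 1
  have hl : (List.ofFn fun a => del (g := g) (r (s a)) (r' a))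
      = (List.ofFn fun a => (r (s a), r' a)).map fun p => del p.1 p.2 := by
    rw [List.map_ofFn]; rfl
  rw [hl, List.foldr_map, (foldr_del_tsum_quadExp (sum_shiftWeight_nonneg σ) (abs_gram_le σ)
    (isSymm_gram σ) (fun τ hτ => rapidDecay_quadExp_gram σ hτ)
    (fun τ hτ => thetaConst_pow_eq_tsum σ n hτ) _ τ hτ).1]
  refine tsum_congr fun P => ?_
  rw [List.map_ofFn, List.prod_ofFn, quadExp_gram]
  congr 1
  refine Finset.prod_congr rfl fun c _ => ?_
  simp only [Function.comp_apply, gram, Matrix.of_apply]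
  push_cast
  rw [Finset.mul_sum]
  refine Finset.sum_congr rfl fun a _ => ?_
  ring

theorem lineDeriv_tsum_thetaTerm {τ : Matrix (Fin g) (Fin g) ℂ} {w : (Fin g → ℤ) → ℂ}
    {z : Fin g → ℂ} (h : RapidDecay (shiftWeight σ) fun p => w p * thetaTerm σ τ z p)
    (i : Fin g) :
    dz i (fun z => ∑' p, w p * thetaTerm σ τ z p) z
      = ∑' p, 4 * Real.pi * Complex.I * shiftVec σ p i * w p * thetaTerm σ τ z p := by
  have := h.hasDerivAt (b := fun p => 4 * Real.pi * Complex.I * shiftVec σ p i)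
    (C := 4 * Real.pi) (shiftWeight_nonneg σ) fun p => by
      have h3 : ‖(4 * Real.pi * Complex.I : ℂ)‖ = 4 * Real.pi := by
        simp [abs_of_pos Real.pi_pos]
      rw [norm_mul, h3, Complex.norm_real, Real.norm_eq_abs]
      exact mul_le_mul_of_nonneg_left (abs_shiftVec_le σ p _) (by positivity)
  have h2 : HasLineDerivAt ℂ (fun z => ∑' p, w p * thetaTerm σ τ z p) _ z
      (Pi.single i (1 : ℂ)) := this.congr_of_eventuallyEq (Filter.Eventually.of_forall fun t => by
    refine tsum_congr fun p => ?_
    have h4 : thetaTerm σ τ (z + t • Pi.single i (1 : ℂ)) p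
        = Complex.exp (t * (4 * Real.pi * Complex.I * shiftVec σ p i)) * thetaTerm σ τ z p := by
      unfold thetaTerm
      rw [← Complex.exp_add]
      congr 1
      simp only [Pi.add_apply, Pi.smul_apply, smul_eq_mul, mul_add, Finset.sum_add_distrib,
        Pi.single_apply, mul_ite, mul_one, mul_zero, Finset.sum_ite_eq', Finset.mem_univ, if_true]
      ring
    rw [h4]
    ring)
  rw [dz, h2.lineDeriv]
  exact tsum_congr fun p => by ring

/-- The heat equation: two `z`-derivatives multiply a term by `(4πi)² qᵢ qⱼ`, which is `8πi` times
the factor `2πi qᵢ qⱼ` produced by `∂_{ij}`. -/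
theorem dz_dz_thetaTwo {τ : Matrix (Fin g) (Fin g) ℂ} (hτ : τ ∈ convDomain g) (i j : Fin g) :
    dz i (dz j (thetaTwo σ τ)) 0 = 8 * Real.pi * Complex.I * del i j (thetaConst σ) τ := by
  have h1 : thetaTwo σ τ = fun z => ∑' p, (1 : ℂ) * thetaTerm σ τ z p := by
    funext z
    simp [thetaTwo_eq_tsum]
  have h2 : dz j (thetaTwo σ τ) = fun z => ∑' p,
      4 * Real.pi * Complex.I * shiftVec σ p j * 1 * thetaTerm σ τ z p := by
    funext z
    rw [h1, lineDeriv_tsum_thetaTerm σ (by simpa using rapidDecay_thetaTerm σ hτ z)]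
  have h3 : RapidDecay (shiftWeight σ) fun p =>
      4 * Real.pi * Complex.I * shiftVec σ p j * 1 * thetaTerm σ τ 0 p :=
    (rapidDecay_thetaTerm σ hτ 0).mul_of_norm_le (C := 4 * Real.pi) (shiftWeight_nonneg σ)
      fun p => by
        have h3 : ‖(4 * Real.pi * Complex.I : ℂ)‖ = 4 * Real.pi := by
          simp [abs_of_pos Real.pi_pos]
        rw [mul_one, norm_mul, h3, Complex.norm_real, Real.norm_eq_abs]
        exact mul_le_mul_of_nonneg_left (abs_shiftVec_le σ p _) (by positivity)
  rw [h2, lineDeriv_tsum_thetaTerm σ h3, del_thetaConst σ hτ, ← tsum_mul_left]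
  exact tsum_congr fun p => by ring

end Theta

/-! ### Freitag's matrix of powers of theta constants -/

theorem minorDet_map_subtype {α : Type} [LinearOrder α] {R : Type*} [CommRing R] {p q : α → Prop}
    (A : Matrix α α R) (I : Finset {x // p x}) (J : Finset {x // q x}) :
    minorDet A (I.map (Function.Embedding.subtype _)) (J.map (Function.Embedding.subtype _))
      = minorDet (A.submatrix Subtype.val Subtype.val) I J := by
  have key : ∀ {p : α → Prop} {k : ℕ} (I : Finset {x // p x}) (hI : I.card = k)
      (hI' : (I.map (Function.Embedding.subtype _)).card = k) (x : Fin k),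
      (I.map (Function.Embedding.subtype _)).orderEmbOfFin hI' x
        = (I.orderEmbOfFin hI x : α) := fun {p} {k} I hI hI' x => by
    have := Finset.orderEmbOfFin_unique hI' (f := fun x => (I.orderEmbOfFin hI x : α))
      (fun x => Finset.mem_map_of_mem (Function.Embedding.subtype _)
        (I.orderEmbOfFin_mem hI x))
      fun a b hab => (I.orderEmbOfFin hI).strictMono hab
    exact (congrFun this x).symm
  by_cases h : J.card = I.card
  · rw [minorDet_eq A (Finset.card_map _) ((Finset.card_map _).trans h), minorDet_eq _ rfl h]
    congr 1
    ext a b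
    simp only [Matrix.submatrix_apply]
    rw [key I rfl, key J h]
  · rw [minorDet, minorDet, dif_neg h, dif_neg (by simpa using h)]

/-- The increasing enumeration of the complement of a point. -/
def succAboveOrderIso {n : ℕ} (i : Fin (n + 1)) : Fin n ≃o {x : Fin (n + 1) // x ≠ i} where
  toEquiv := finSuccAboveEquiv i
  map_rel_iff' := by
    intro a b
    rw [finSuccAboveEquiv_apply, finSuccAboveEquiv_apply, Subtype.mk_le_mk]
    exact (Fin.succAboveOrderEmb i).le_iff_le

theorem isSymm_delMatrix {g : ℕ} (f : Matrix (Fin g) (Fin g) ℂ → ℂ)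
    (τ : Matrix (Fin g) (Fin g) ℂ) : (delMatrix f τ).IsSymm := by
  ext i j
  have h : coordVec j i = coordVec i j := by
    ext a b
    simp only [coordVec, Matrix.of_apply]
    congr 1
    exact propext or_comm
  simp only [delMatrix, Matrix.transpose_apply, Matrix.of_apply, del, h, eq_comm]

/-- The binomial weights in Freitag's matrix exactly cancel the dependence on `k` of the two falling
factorials. -/
theorem descFactorial_mul_descFactorial_div_choose {n k : ℕ} (hk : k ≤ n) :
    ((n.descFactorial k : ℂ) * n.descFactorial (n - k)) / n.choose k = n.factorial := by
  have h0 : (n.choose k : ℂ) ≠ 0 := by exact_mod_cast (Nat.choose_pos hk).ne'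
  rw [div_eq_iff h0]
  have h1 := Nat.factorial_mul_descFactorial (Nat.sub_le n k)
  rw [Nat.sub_sub_self hk] at h1
  have h2 := Nat.descFactorial_eq_factorial_mul_choose n k
  rw [h2, ← h1]
  push_cast
  ring

/-- The powers `Θ[ε]^(n-k)` and `Θ[δ]^k` left over by the minors of `∂` are exactly the scalars that
the Laplace expansion of a minor of `Θ[ε] ∂Θ[δ] - Θ[δ] ∂Θ[ε]` pulls out of its blocks. -/
theorem freitagMatrix_thetaConst_pow {n : ℕ} (ε δ : Fin (n + 1) → ZMod 2)
    {τ : Matrix (Fin (n + 1)) (Fin (n + 1)) ℂ} (hτ : τ ∈ convDomain (n + 1)) :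
    freitagMatrix (thetaConst ε ^ n) (thetaConst δ ^ n) τ = (n.factorial : ℂ) •
      (thetaConst ε τ • delMatrix (thetaConst δ) τ -
        thetaConst δ τ • delMatrix (thetaConst ε) τ).adjugate := by
  set D := thetaConst ε τ • delMatrix (thetaConst δ) τ -
        thetaConst δ τ • delMatrix (thetaConst ε) τ with hD
  have hDs : D.IsSymm := ((isSymm_delMatrix _ _).smul _).sub ((isSymm_delMatrix _ _).smul _)
  have hadj : D.adjugate.IsSymm := by
    rw [Matrix.IsSymm, Matrix.adjugate_transpose, hDs.eq]
  ext i j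
  -- The adjugate is the transposed cofactor matrix; its symmetry allows deleting row `i` and column
  -- `j`, as in Freitag's matrix.
  rw [← hadj, Matrix.smul_apply, Matrix.transpose_apply, Matrix.adjugate_fin_succ_eq_det_submatrix,
    smul_eq_mul, mul_left_comm]
  simp only [freitagMatrix, Matrix.of_apply, Nat.add_sub_cancel]
  congr 1
  -- The `ε`-part comes first because its minors have size `k`; its minus sign yields `(-1)^k`.
  have hsub : D.submatrix i.succAbove j.succAbove =
      (((-thetaConst δ τ) • (delMatrix (thetaConst ε) τ).submatrix Subtype.val Subtype.val +
        thetaConst ε τ • (delMatrix (thetaConst δ) τ).submatrix Subtype.val Subtype.val :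
          Matrix {x // x ≠ i} {x // x ≠ j} ℂ)).submatrix
        (succAboveOrderIso i) (succAboveOrderIso j) := by
    ext a b
    simp only [hD, Matrix.submatrix_apply, Matrix.add_apply, Matrix.sub_apply, Matrix.smul_apply,
      smul_eq_mul]
    have e : ∀ (i : Fin (n + 1)) (a : Fin n),
      (succAboveOrderIso i a : Fin (n + 1)) = i.succAbove a := fun i a => rfl
    rw [e, e]
    ring
  rw [hsub, det_add_submatrix_orderIso, Finset.mul_sum]
  refine Finset.sum_congr rfl fun k hk => ?_
  have hkn : k ≤ n := Nat.lt_succ_iff.1 (Finset.mem_range.1 hk)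
  simp only [Finset.mul_sum]
  refine Finset.sum_congr rfl fun I hI => Finset.sum_congr rfl fun J hJ => ?_
  have hI' := (Finset.mem_powersetCard.1 hI).2
  have hJ' := (Finset.mem_powersetCard.1 hJ).2
  have hcompl : ∀ (i : Fin (n + 1)) (I : Finset {x // x ≠ i}), I.card = k →
      Iᶜ.card = n - k := fun i I hI => by
    rw [Finset.card_compl, hI, ← Fintype.card_congr (succAboveOrderIso i).toEquiv,
      Fintype.card_fin]
  rw [delMinor_thetaConst_pow ε n hτ ((Finset.card_map _).trans hI')
      ((Finset.card_map _).trans hJ'),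
    delMinor_thetaConst_pow δ n hτ ((Finset.card_map _).trans (hcompl i I hI'))
      ((Finset.card_map _).trans (hcompl j J hJ')), minorDet_map_subtype, minorDet_map_subtype,
    minorDet_smul, minorDet_smul, hI', hcompl i I hI', Nat.sub_sub_self hkn,
    ← descFactorial_mul_descFactorial_div_choose hkn, neg_pow]
  ring

theorem delMatrix_div_thetaConst {g : ℕ} (ε δ : Fin g → ZMod 2)
    {τ : Matrix (Fin g) (Fin g) ℂ} (hτ : τ ∈ convDomain g) (h0 : thetaConst δ τ ≠ 0) :
    thetaADel ε δ τ = -((4 * Real.pi * Complex.I * thetaConst δ τ ^ 2 : ℂ) •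
      delMatrix (thetaConst ε / thetaConst δ) τ) := by
  ext i j
  have hdiv : lineDeriv ℂ (thetaConst ε / thetaConst δ) τ (coordVec i j)
      = (lineDeriv ℂ (thetaConst ε) τ (coordVec i j) * thetaConst δ τ -
        thetaConst ε τ * lineDeriv ℂ (thetaConst δ) τ (coordVec i j)) / thetaConst δ τ ^ 2 := by
    have h1 := (lineDifferentiableAt_thetaConst ε hτ (coordVec i j)).hasLineDerivAt
    have h2 := (lineDifferentiableAt_thetaConst δ hτ (coordVec i j)).hasLineDerivAt
    have h3 := HasDerivAt.div h1 h2 (by simpa using h0)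
    simp only [zero_smul, add_zero] at h3
    exact HasLineDerivAt.lineDeriv h3
  simp only [thetaADel, delMatrix, del, Matrix.smul_apply, Matrix.sub_apply, Matrix.neg_apply,
    Matrix.of_apply, smul_eq_mul, hdiv]
  field_simp
  ring

theorem thetaA_eq_two_smul {g : ℕ} (ε δ : Fin g → ZMod 2) {τ : Matrix (Fin g) (Fin g) ℂ}
    (hτ : τ ∈ convDomain g) : thetaA ε δ τ = (2 : ℂ) • thetaADel ε δ τ := by
  ext i j
  simp only [thetaA, thetaADel, delMatrix, Matrix.smul_apply, Matrix.sub_apply, Matrix.of_apply,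
    smul_eq_mul, dz_dz_thetaTwo _ hτ]
  ring

theorem adjugate_thetaADel {n : ℕ} (ε δ : Fin (n + 1) → ZMod 2)
    {τ : Matrix (Fin (n + 1)) (Fin (n + 1)) ℂ} (hτ : τ ∈ convDomain (n + 1)) :
    (thetaADel ε δ τ).adjugate = ((4 * Real.pi * Complex.I) ^ n / (n.factorial : ℂ)) •
      freitagMatrix (thetaConst ε ^ n) (thetaConst δ ^ n) τ := by
  have h0 : (n.factorial : ℂ) ≠ 0 := by exact_mod_cast n.factorial_ne_zero
  rw [freitagMatrix_thetaConst_pow ε δ hτ, thetaADel, Matrix.adjugate_smul, Fintype.card_fin,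
    Nat.add_sub_cancel, smul_smul, div_mul_cancel₀ _ h0]

theorem isSymm_freitagMatrix_thetaConst_pow {n : ℕ} (ε δ : Fin (n + 1) → ZMod 2)
    {τ : Matrix (Fin (n + 1)) (Fin (n + 1)) ℂ} (hτ : τ ∈ convDomain (n + 1)) :
    (freitagMatrix (thetaConst ε ^ n) (thetaConst δ ^ n) τ).IsSymm := by
  rw [freitagMatrix_thetaConst_pow ε δ hτ]
  refine Matrix.IsSymm.smul ?_ _
  rw [Matrix.IsSymm, Matrix.adjugate_transpose]
  congr 1
  exact ((isSymm_delMatrix _ _).smul _).sub ((isSymm_delMatrix _ _).smul _)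

end SiegelTheta

end

/-! ### Uniqueness of `B` and the adjugate identities. -/

theorem mainTheorem3 (g : ℕ) (hg : 2 ≤ g) (ε δ : Fin g → ZMod 2) (hεδ : ε ≠ δ) :
    -- Freitag's matrix is a symmetric matrix `B` with `{Θ[ε]^(g-1), Θ[δ]^(g-1)} = tr (B dτ̌)` ...
    ((∀ τ ∈ SiegelTheta.siegelUpperHalfSpace g,
        (SiegelTheta.freitagMatrix (SiegelTheta.thetaConst ε ^ (g - 1))
          (SiegelTheta.thetaConst δ ^ (g - 1)) τ).IsSymm ∧
        SiegelTheta.freitagPairing (SiegelTheta.thetaConst ε ^ (g - 1))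
            (SiegelTheta.thetaConst δ ^ (g - 1)) τ =
          SiegelTheta.traceForm (SiegelTheta.freitagMatrix (SiegelTheta.thetaConst ε ^ (g - 1))
            (SiegelTheta.thetaConst δ ^ (g - 1)) τ))) ∧
    -- ... and for every such `B`:
    ∀ B : Matrix (Fin g) (Fin g) ℂ → Matrix (Fin g) (Fin g) ℂ,
      (∀ τ ∈ SiegelTheta.siegelUpperHalfSpace g, (B τ).IsSymm) →
      (∀ τ ∈ SiegelTheta.siegelUpperHalfSpace g,
        SiegelTheta.freitagPairing (SiegelTheta.thetaConst ε ^ (g - 1))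
          (SiegelTheta.thetaConst δ ^ (g - 1)) τ = SiegelTheta.traceForm (B τ)) →
      ∀ τ ∈ SiegelTheta.siegelUpperHalfSpace g,
        -- the identity for `A = 4πi (Θ[ε] ∂Θ[δ] - Θ[δ] ∂Θ[ε])`
        (SiegelTheta.thetaADel ε δ τ).adjugate =
          ((4 * Real.pi * Complex.I) ^ (g - 1) / ((g - 1).factorial : ℂ)) • B τ ∧
        -- this matrix in terms of second derivatives in `z`, and the identity in these terms
        SiegelTheta.thetaA ε δ τ = (2 : ℂ) • SiegelTheta.thetaADel ε δ τ ∧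
        (SiegelTheta.thetaA ε δ τ).adjugate =
          ((8 * Real.pi * Complex.I) ^ (g - 1) / ((g - 1).factorial : ℂ)) • B τ ∧
        -- this matrix in terms of the derivative of the quotient
        (SiegelTheta.thetaConst δ τ ≠ 0 →
          SiegelTheta.thetaADel ε δ τ =
            -((4 * Real.pi * Complex.I * SiegelTheta.thetaConst δ τ ^ 2 : ℂ) •
              SiegelTheta.delMatrix (SiegelTheta.thetaConst ε / SiegelTheta.thetaConst δ) τ)) ∧
        -- equality of the differential forms
        SiegelTheta.traceForm (SiegelTheta.thetaADel ε δ τ).adjugate =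
          ((4 * Real.pi * Complex.I) ^ (g - 1) / ((g - 1).factorial : ℂ)) •
            SiegelTheta.freitagPairing (SiegelTheta.thetaConst ε ^ (g - 1))
              (SiegelTheta.thetaConst δ ^ (g - 1)) τ := by

  obtain ⟨n, rfl⟩ : ∃ n, g = n + 1 := ⟨g - 1, by omega⟩
  simp only [Nat.add_sub_cancel]
  have hU := fun τ hτ => SiegelTheta.siegelUpperHalfSpace_subset_convDomain (n + 1) (a := τ) hτ
  refine ⟨fun τ hτ => ⟨SiegelTheta.isSymm_freitagMatrix_thetaConst_pow ε δ (hU τ hτ), rfl⟩,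
    fun B hB hBf τ hτ => ?_⟩
  have hBeq : SiegelTheta.freitagMatrix (SiegelTheta.thetaConst ε ^ n)
      (SiegelTheta.thetaConst δ ^ n) τ = B τ :=
    SiegelTheta.traceForm_injective
      (SiegelTheta.isSymm_freitagMatrix_thetaConst_pow ε δ (hU τ hτ)) (hB τ hτ) (hBf τ hτ)
  have hadj := SiegelTheta.adjugate_thetaADel ε δ (hU τ hτ)
  have htwo := SiegelTheta.thetaA_eq_two_smul ε δ (hU τ hτ)
  refine ⟨hBeq ▸ hadj, htwo, ?_, SiegelTheta.delMatrix_div_thetaConst ε δ (hU τ hτ), ?_⟩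
  -- The adjugate is homogeneous of degree `n = g - 1`, so the factor `2` turns `(4πi)^n` into
  -- `(8πi)^n`.
  · rw [htwo, Matrix.adjugate_smul, hadj, hBeq, smul_smul, Fintype.card_fin, Nat.add_sub_cancel,
      mul_div_assoc', ← mul_pow]
    congr 3
    ring
  · rw [hadj, SiegelTheta.traceForm_smul]
    rfl
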